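/- All graphs are finite, simple and connected. A \emph{cactus} is a graph $G$ in which any two distinct cycles are edge disjoint. For $u\in V(G)$ and an edge $vw$ put $d(u,vw)=\min\{d(u,v),d(u,w)\}$. A set $S\subseteq V(G)$ is a \emph{vertex} (resp. \emph{edge}) \emph{metric generator} if for every two distinct vertices (resp. edges) $x,x'$ of $G$ there is $s\in S$ with $d(s,x)\neq d(s,x')$. A \emph{thread} hanging at a vertex $v$ of degree $\geq 3$ is a path $u_1u_2\cdots u_m$ ($m\ge 1$) such that $u_1$ is a leaf, $u_2,\ldots,u_m$ have degree $2$, and $u_m$ is adjacent to $v$; its \emph{length} is $m=d(u_1,v)$. It is \emph{$S$-free} if it contains no vertex of $S$. The set $S$ is \emph{branch-resolving} if at most one $S$-free thread hangs at every vertex of degree $\ge 3$. A vertex $v$ of a cycle $C$ is \emph{$S$-active} on $C$ if the connected component of $G-E(C)$ containing $v$ contains a vertex of $S$; $a_S(C)$ is the number of $S$-active vertices on $C$, and $S$ is \emph{biactive} if $a_S(C)\ge 2$ for every cycle $C$ of $G$. Let $S$ be biactive and branch-resolving, and let $C=v_0v_1\cdots v_{g-1}$ be a cycle of length $g$ (indices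 modulo $g$), \emph{canonically labeled}, i.e. $v_0$ is $S$-active and $k=\max\{i\in[0,g-1]:v_i\text{ is }S\text{-active}\}$ is as small as possible among all labelings of $C$ that start at an $S$-active vertex. With respect to $S$, the labeled cycle $C$ contains configuration \begin{itemize} \item $\mathcal A$ if $a_S(C)=2$, $g$ is even, and $k=g/2$; \item $\mathcal B$ if $k\le\lfloor g/2\rfloor-1$ and there is an $S$-free thread hanging at $v_i$ for some $i\in[k,\lfloor g/2\rfloor-1]\cup[\lceil g/2\rceil+k+1,g-1]\cup\{0\}$; \item $\mathcal C$ if $a_S(C)=2$, $g$ is even, $k\le g/2$, and there is an $S$-free thread of length $\ge g/2-k$ hanging at $v_i$ for some $i\in[0,k]$; \item $\mathcal D$ if $k\le\lceil g/2\rceil-1$ and there is an $S$-free thread hanging at $v_i$ for some $i\in[k,\lceil g/2\rceil-1]\cup[\lfloor g/2\rfloor+k+1,g-1]\cup\{0\}$; \item $\mathcal E$ if $a_S(C)=2$ and for some $i\in[0,k]$ there is an $S$-free thread of length $\ge\lfloor g/2\rfloor-k+1$ hanging at $v_i$ and, if $g$ is even, also an $S$-free thread hanging at $v_j$ with $j=g/2+k-i$.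 \end{itemize} A cycle contains a configuration if it does so under some canonical labeling. An \emph{$S$-path} of a cycle $C$ of length $g$ is a shortest subpath of $C$ containing all $S$-active vertices of $C$. A vertex $v$ of $C$ is \emph{vertex-critical} (resp. \emph{edge-critical}) on $C$ if it is an end-vertex of an $S$-path $P$ of $C$ of length $|P|\le\lfloor g/2\rfloor-1$ (resp. $|P|\le\lceil g/2\rceil-1$). Two distinct cycles are \emph{vertex-critically} (resp. \emph{edge-critically}) \emph{incident} with respect to $S$ if they share a vertex that is vertex-critical (resp. edge-critical) on both of them. \textbf{Theorem.} Let $G$ be a cactus graph that is not a path (a single vertex counts as a path), and let $S$ be a biactive branch-resolving set in $G$. Then $S$ is a vertex (resp. an edge) metric generator of $G$ if and only if no cycle of $G$ contains any of the configurations $\mathcal A,\mathcal B,\mathcal C$ (resp. $\mathcal A,\mathcal D,\mathcal E$) with respect to $S$, and no two distinct cycles of $G$ are vertex-critically (resp. edge-critically) incident with respect to $S$. -/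

import Mathlib

namespace SimpleGraph

variable {V : Type*}

/-- The distance from the vertex `s` to the edge `e = ab`: the minimum of `d(s,a)` and `d(s,b)`. -/
noncomputable def edgeDist (G : SimpleGraph V) (s : V) (e : Sym2 V) : ℕ :=
  Sym2.lift ⟨fun a b => min (G.dist s a) (G.dist s b), fun _ _ => min_comm _ _⟩ e

/-- Every two distinct vertices are distinguished by some vertex of `S`. -/
def IsVertexMetricGenerator (G : SimpleGraph V) (S : Set V) : Prop :=
  ∀ x y : V, x ≠ y → ∃ s ∈ S, G.dist s x ≠ G.dist s y

/-- Every two distinct edges are distinguished by some vertex of `S`. -/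
def IsEdgeMetricGenerator (G : SimpleGraph V) (S : Set V) : Prop :=
  ∀ e ∈ G.edgeSet, ∀ f ∈ G.edgeSet, e ≠ f → ∃ s ∈ S, G.edgeDist s e ≠ G.edgeDist s f

/-- A cactus: a connected graph in which distinct cycles are edge disjoint. Here and below a cycle
is given by a closed walk running once around it, and two such closed walks represent the same
cycle exactly when they have the same edge set. -/
def IsCactus (G : SimpleGraph V) : Prop :=
  G.Connected ∧ ∀ (u v : V) (p : G.Walk u u) (q : G.Walk v v), p.IsCycle → q.IsCycle →
    p.edgeSet ≠ q.edgeSet → Disjoint p.edgeSet q.edgeSet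

/-- The list `l = [u₁, …, u_k]` is a thread hanging at `v`: `v` has degree at least 3, `u₁ ⋯ u_k`
is a path with at least one vertex, `u₁` is a leaf, `u₂, …, u_k` have degree 2, and `u_k` is
adjacent to `v`. -/
def IsThread (G : SimpleGraph V) [G.LocallyFinite] (v : V) (l : List V) : Prop :=
  3 ≤ G.degree v ∧ l.IsChain G.Adj ∧ l.Nodup ∧ (∃ u ∈ l.head?, G.degree u = 1) ∧
    (∀ u ∈ l.tail, G.degree u = 2) ∧ ∃ u ∈ l.getLast?, G.Adj u v

/-- A thread hanging at `v` without a vertex of `S`. -/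
def IsFreeThread (G : SimpleGraph V) [G.LocallyFinite] (S : Set V) (v : V) (l : List V) : Prop :=
  G.IsThread v l ∧ ∀ u ∈ l, u ∉ S

/-- At most one `S`-free thread hangs at every vertex (of degree at least 3). -/
def IsBranchResolving (G : SimpleGraph V) [G.LocallyFinite] (S : Set V) : Prop :=
  ∀ (v : V) (l l' : List V), G.IsFreeThread S v l → G.IsFreeThread S v l' → l = l'

/-- The vertices `v` of the cycle `p` for which the connected component of `v` in `G - E(p)`
contains a vertex of `S`. -/
def activeSet (G : SimpleGraph V) (S : Set V) {u : V} (p : G.Walk u u) : Set V :=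
  {v | v ∈ p.support ∧ ∃ s ∈ S, (G.deleteEdges p.edgeSet).Reachable v s}

/-- Every cycle has at least two `S`-active vertices. -/
def IsBiactive (G : SimpleGraph V) (S : Set V) : Prop :=
  ∀ (u : V) (p : G.Walk u u), p.IsCycle → 2 ≤ (G.activeSet S p).encard

/-- The number `k = max {i : v_i is S-active}` for the cycle `p = v_0 v_1 ⋯ v_{g-1}`, where
`v_i` is `p.getVert i` and `g` is `p.length`. -/
noncomputable def lastActive (G : SimpleGraph V) (S : Set V) {u : V} (p : G.Walk u u) : ℕ :=
  sSup {i | i < p.length ∧ p.getVert i ∈ G.activeSet S p}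

/-- `p = v_0 v_1 ⋯ v_{g-1}` is a canonical labelling of its cycle: `v_0` is `S`-active and `k` is
as small as possible among all labellings of the same cycle that start at an `S`-active vertex. -/
def IsCanonicalCycle (G : SimpleGraph V) (S : Set V) {u : V} (p : G.Walk u u) : Prop :=
  p.IsCycle ∧ u ∈ G.activeSet S p ∧
    ∀ (w : V) (q : G.Walk w w), q.IsCycle → q.edgeSet = p.edgeSet → w ∈ G.activeSet S q →
      G.lastActive S p ≤ G.lastActive S q

section Configurations

/-! The configurations, for a canonically labelled cycle `p` of length `g = p.length` and
`k = G.lastActive S p`. In natural numbers `⌊g/2⌋` is `g / 2` and `⌈g/2⌉` is `(g + 1) / 2`;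
inequalities are written without subtraction. The length of a thread `u₁ ⋯ u_k` hanging at `v` is
the distance from the leaf `u₁` to `v`, i.e. the number of its vertices. -/

/-- `a_S(C) = 2`, `g` is even and `k = g/2`. -/
def ConfigA (G : SimpleGraph V) (S : Set V) {u : V} (p : G.Walk u u) : Prop :=
  (G.activeSet S p).encard = 2 ∧ Even p.length ∧ G.lastActive S p = p.length / 2

/-- `k ≤ ⌊g/2⌋ - 1` and an `S`-free thread hangs at some `v_i` with
`i ∈ [k, ⌊g/2⌋ - 1] ∪ [⌈g/2⌉ + k + 1, g - 1] ∪ {0}`. -/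
def ConfigB (G : SimpleGraph V) [G.LocallyFinite] (S : Set V) {u : V} (p : G.Walk u u) : Prop :=
  G.lastActive S p + 1 ≤ p.length / 2 ∧
    ∃ i : ℕ, ((G.lastActive S p ≤ i ∧ i + 1 ≤ p.length / 2) ∨
        ((p.length + 1) / 2 + G.lastActive S p + 1 ≤ i ∧ i + 1 ≤ p.length) ∨ i = 0) ∧
      ∃ l, G.IsFreeThread S (p.getVert i) l

/-- `a_S(C) = 2`, `g` is even, `k ≤ g/2` and an `S`-free thread of length at least `g/2 - k` hangs
at some `v_i` with `i ∈ [0, k]`. -/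
def ConfigC (G : SimpleGraph V) [G.LocallyFinite] (S : Set V) {u : V} (p : G.Walk u u) : Prop :=
  (G.activeSet S p).encard = 2 ∧ Even p.length ∧ G.lastActive S p ≤ p.length / 2 ∧
    ∃ i ≤ G.lastActive S p, ∃ l, G.IsFreeThread S (p.getVert i) l ∧
      p.length / 2 ≤ l.length + G.lastActive S p

/-- `k ≤ ⌈g/2⌉ - 1` and an `S`-free thread hangs at some `v_i` with
`i ∈ [k, ⌈g/2⌉ - 1] ∪ [⌊g/2⌋ + k + 1, g - 1] ∪ {0}`. -/
def ConfigD (G : SimpleGraph V) [G.LocallyFinite] (S : Set V) {u : V} (p : G.Walk u u) : Prop :=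
  G.lastActive S p + 1 ≤ (p.length + 1) / 2 ∧
    ∃ i : ℕ, ((G.lastActive S p ≤ i ∧ i + 1 ≤ (p.length + 1) / 2) ∨
        (p.length / 2 + G.lastActive S p + 1 ≤ i ∧ i + 1 ≤ p.length) ∨ i = 0) ∧
      ∃ l, G.IsFreeThread S (p.getVert i) l

/-- `a_S(C) = 2` and an `S`-free thread of length at least `⌊g/2⌋ - k + 1` hangs at some `v_i` with
`i ∈ [0, k]`; moreover, if `g` is even, an `S`-free thread hangs at `v_j` with `j = g/2 + k - i`. -/
def ConfigE (G : SimpleGraph V) [G.LocallyFinite] (S : Set V) {u : V} (p : G.Walk u u) : Prop :=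
  (G.activeSet S p).encard = 2 ∧
    ∃ i ≤ G.lastActive S p,
      (∃ l, G.IsFreeThread S (p.getVert i) l ∧
        p.length / 2 + 1 ≤ l.length + G.lastActive S p) ∧
      (Even p.length →
        ∃ l, G.IsFreeThread S (p.getVert (p.length / 2 + G.lastActive S p - i)) l)

end Configurations

/-- The walk `P` is a subpath of the cycle `p` that contains all `S`-active vertices of `p`. -/
def IsActivePath (G : SimpleGraph V) (S : Set V) {u : V} (p : G.Walk u u) {a b : V}
    (P : G.Walk a b) : Prop :=
  P.IsPath ∧ P.edgeSet ⊆ p.edgeSet ∧ (∀ v ∈ P.support, v ∈ p.support) ∧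
    ∀ v ∈ G.activeSet S p, v ∈ P.support

/-- `P` is an `S`-path of the cycle `p`: a shortest subpath of `p` containing all `S`-active
vertices of `p`. -/
def IsSPath (G : SimpleGraph V) (S : Set V) {u : V} (p : G.Walk u u) {a b : V}
    (P : G.Walk a b) : Prop :=
  G.IsActivePath S p P ∧
    ∀ (c d : V) (Q : G.Walk c d), G.IsActivePath S p Q → P.length ≤ Q.length

/-- `v` is an end-vertex of an `S`-path of `p` of length at most `⌊g/2⌋ - 1`. -/
def IsVertexCritical (G : SimpleGraph V) (S : Set V) {u : V} (p : G.Walk u u) (v : V) : Prop :=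
  ∃ (a b : V) (P : G.Walk a b), G.IsSPath S p P ∧ (v = a ∨ v = b) ∧ P.length + 1 ≤ p.length / 2

/-- `v` is an end-vertex of an `S`-path of `p` of length at most `⌈g/2⌉ - 1`. -/
def IsEdgeCritical (G : SimpleGraph V) (S : Set V) {u : V} (p : G.Walk u u) (v : V) : Prop :=
  ∃ (a b : V) (P : G.Walk a b), G.IsSPath S p P ∧ (v = a ∨ v = b) ∧
    P.length + 1 ≤ (p.length + 1) / 2

/-- The cycles `p` and `q` are distinct and share a vertex that is vertex-critical on both. -/
def VertexCriticallyIncident (G : SimpleGraph V) (S : Set V) {u w : V} (p : G.Walk u u)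
    (q : G.Walk w w) : Prop :=
  p.edgeSet ≠ q.edgeSet ∧ ∃ v, v ∈ p.support ∧ v ∈ q.support ∧
    G.IsVertexCritical S p v ∧ G.IsVertexCritical S q v

/-- The cycles `p` and `q` are distinct and share a vertex that is edge-critical on both. -/
def EdgeCriticallyIncident (G : SimpleGraph V) (S : Set V) {u w : V} (p : G.Walk u u)
    (q : G.Walk w w) : Prop :=
  p.edgeSet ≠ q.edgeSet ∧ ∃ v, v ∈ p.support ∧ v ∈ q.support ∧
    G.IsEdgeCritical S p v ∧ G.IsEdgeCritical S q v

end SimpleGraph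

/-! The vertex and edge versions run in parallel, with `κ = 1` for vertices and `κ = 0` for edges.
Deleting the edges of a cycle `p` leaves exactly one component per cycle vertex, for otherwise a
second cycle would share an edge with `p`. So every vertex `x` has a gate `gateIdx p x`, and
distances between different components are sums through gates (`dist_getVert`,
`dist_eq_of_gateIdx_ne`).

Undistinguished pairs come from two mechanisms. The first is local: two free edges at one vertex
`w`, both leading away from all of `S` (`HasFreePair`). Their other ends are then all one step
farther than `w` (`κ = 1`), or the edges are all exactly as far as `w` (`κ = 0`). A free bridge has
a far side without `S`; biactivity forbids cycles there and branch resolution forbids branching, so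
that side is a path. A free cycle edge means that, in the labelling starting at `w` and closing with
this edge, all active vertices lie in the first half. Two free bridges at `w` are thus impossible
unless `G` is a path, a bridge and a cycle edge give configuration B or D, edges of two cycles give
critical incidence, and two edges of one cycle contradict biactivity
(`exists_configThread_or_criticallyIncident`). Conversely, B, D and critical incidence each exhibit
a free pair.

The second mechanism lives on one cycle of length `g`. Let two undistinguished objects sit over
distinct positions `P`, `P'` at heights `H ≥ H'`, all distances being doubled so that edges have
positions too. By `located_cases` there are two possibilities. Either all of `S` sees the second
object through `P`, which yields a free pair at `P`, or every active position `t` satisfies `d(t, P)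
+ H = d(t, P') + H'`. This equation has at most one vertex solution on each arc between `P` and
`P'`, so there are exactly two active vertices, and the arithmetic gives `2k + H = g + H'`. Equal
heights are configuration A; unequal heights force a free thread at `P`, hence C or E. Conversely,
A, C and E come with explicit undistinguished pairs.

If no cycle separates the pair, it is joined by bridges only, and the midpoint of a shortest path
carries a free pair (`hasFreePair_of_vertices`, `hasFreePair_of_edges`). -/

namespace SimpleGraph

variable {V : Type*} {G : SimpleGraph V}

/-! ### Lower bounds for distances -/

/-- A function growing by at most one along each edge bounds distances from below. The exact
distance formulas for gates and bridges come from choosing such a function to be the claimed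
distance. -/
lemma Walk.apply_le_apply_add_length {F : V → ℕ} (hF : ∀ z z', G.Adj z z' → F z' ≤ F z + 1)
    {x y : V} (p : G.Walk x y) : F y ≤ F x + p.length := by
  induction p with
  | nil => simp
  | cons h p ih => have := hF _ _ h; simp only [Walk.length_cons]; omega

lemma Connected.apply_le_apply_add_dist (hG : G.Connected) {F : V → ℕ}
    (hF : ∀ z z', G.Adj z z' → F z' ≤ F z + 1) (x y : V) : F y ≤ F x + G.dist x y := by
  obtain ⟨p, hp⟩ := hG.exists_walk_length_eq_dist x y
  rw [← hp]
  exact p.apply_le_apply_add_length hF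

lemma Connected.dist_le_dist_add_one (hG : G.Connected) (x : V) {z z' : V} (h : G.Adj z z') :
    G.dist x z' ≤ G.dist x z + 1 := by
  have := hG.dist_triangle (u := x) (v := z) (w := z')
  rwa [dist_eq_one_iff_adj.mpr h] at this

lemma Connected.exists_adj_dist_add_one (hG : G.Connected) {w x : V} (h : w ≠ x) :
    ∃ b, G.Adj w b ∧ G.dist b x + 1 = G.dist w x := by
  obtain ⟨p, hp⟩ := hG.exists_walk_length_eq_dist w x
  cases p with
  | nil => exact absurd rfl h
  | cons hadj q =>
    refine ⟨_, hadj, ?_⟩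
    have h1 := G.dist_le q
    have h2 := hG.dist_le_dist_add_one x hadj.symm
    rw [dist_comm, dist_comm (u := x)] at h2
    simp only [Walk.length_cons] at hp
    omega

lemma dist_getVert_le {a b : V} (p : G.Walk a b) (i j : ℕ) :
    G.dist (p.getVert i) (p.getVert j) ≤ (i - j) + (j - i) := by
  wlog hij : i ≤ j generalizing i j
  · rw [dist_comm]
    have := this j i (by omega)
    omega
  have h1 := G.dist_le (((p.drop i).take (j - i)).copy rfl
    (by rw [p.drop_getVert, Nat.add_sub_cancel' hij]))
  have h2 : ((p.drop i).take (j - i)).length ≤ j - i := by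
    rw [Walk.take_length]; exact min_le_left _ _
  rw [Walk.length_copy] at h1
  omega

lemma dist_le_length_of_mem_support {a b x y : V} {p : G.Walk a b} (hx : x ∈ p.support)
    (hy : y ∈ p.support) : G.dist x y ≤ p.length := by
  obtain ⟨i, rfl, hi⟩ := Walk.mem_support_iff_exists_getVert.mp hx
  obtain ⟨j, rfl, hj⟩ := Walk.mem_support_iff_exists_getVert.mp hy
  have := dist_getVert_le p i j
  omega

/-! ### Positions on a cycle -/

lemma Walk.mem_edgeSet_iff_getVert {a b : V} (p : G.Walk a b) (e : Sym2 V) :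
    e ∈ p.edgeSet ↔ ∃ i < p.length, e = s(p.getVert i, p.getVert (i + 1)) := by
  induction p with
  | nil => simp
  | cons h p ih =>
    rw [Walk.edgeSet_cons, Set.mem_insert_iff, ih]
    constructor
    · rintro (rfl | ⟨i, hi, rfl⟩)
      · exact ⟨0, by simp, by simp⟩
      · exact ⟨i + 1, by simpa using hi, by simp⟩
    · rintro ⟨i, hi, rfl⟩
      cases i with
      | zero => left; simp
      | succ i => right; exact ⟨i, by simpa using hi, by simp⟩

lemma Walk.edge_getVert_mem {a b : V} (p : G.Walk a b) {i : ℕ} (hi : i < p.length) :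
    s(p.getVert i, p.getVert (i + 1)) ∈ p.edgeSet :=
  (p.mem_edgeSet_iff_getVert _).mpr ⟨i, hi, rfl⟩

lemma Walk.IsCycle.getVert_inj {u : V} {p : G.Walk u u} (hp : p.IsCycle) {i j : ℕ}
    (hi : i < p.length) (hj : j < p.length) (h : p.getVert i = p.getVert j) : i = j :=
  hp.getVert_injOn' (by simp only [Set.mem_ofPred_eq]; omega)
    (by simp only [Set.mem_ofPred_eq]; omega) h

lemma Walk.exists_getVert_lt {u : V} {p : G.Walk u u} (hp : p.IsCycle) {v : V}
    (hv : v ∈ p.support) : ∃ i < p.length, p.getVert i = v := by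
  obtain ⟨i, rfl, hi⟩ := Walk.mem_support_iff_exists_getVert.mp hv
  have := hp.three_le_length
  rcases hi.lt_or_eq with h | rfl
  · exact ⟨i, h, rfl⟩
  · exact ⟨0, by omega, by simp⟩

lemma Walk.mem_support_iff_mem_edgeSet {u : V} {p : G.Walk u u} (hp : p.IsCycle) (v : V) :
    v ∈ p.support ↔ ∃ e ∈ p.edgeSet, v ∈ e := by
  constructor
  · intro hv
    obtain ⟨i, hi, rfl⟩ := Walk.exists_getVert_lt hp hv
    exact ⟨_, p.edge_getVert_mem hi, by simp⟩
  · rintro ⟨e, he, hv⟩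
    obtain ⟨i, hi, rfl⟩ := (p.mem_edgeSet_iff_getVert e).mp he
    rcases Sym2.mem_iff.mp hv with rfl | rfl <;> exact p.getVert_mem_support _

/-- The neighbours of `v_i` along the cycle are `v_{i-1}` and `v_{i+1}`. -/
lemma Walk.IsCycle.eq_of_edge_mem {u : V} {p : G.Walk u u} (hp : p.IsCycle) {i : ℕ}
    (hi : i + 1 < p.length) {y : V} (h : s(p.getVert (i + 1), y) ∈ p.edgeSet) :
    y = p.getVert i ∨ y = p.getVert (i + 2) := by
  obtain ⟨j, hj, he⟩ := (p.mem_edgeSet_iff_getVert _).mp h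
  rcases Sym2.eq_iff.mp he with ⟨h1, h2⟩ | ⟨h1, h2⟩
  · have := hp.getVert_inj hi hj h1
    subst this
    exact Or.inr h2
  · left
    by_cases hj' : j + 1 < p.length
    · have := hp.getVert_inj hi hj' h1
      rw [h2]; congr 1; omega
    · have : p.getVert (i + 1) = p.getVert 0 := by
        rw [h1, p.getVert_zero, show j + 1 = p.length by omega, p.getVert_length]
      have := hp.getVert_inj hi (by omega) this
      omega

/-- Every cycle can be relabelled so that it starts at any of its vertices. -/
lemma Walk.IsCycle.exists_rotate {u : V} {p : G.Walk u u} (hp : p.IsCycle) {j : ℕ}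
    (hj : j ≤ p.length) :
    ∃ q : G.Walk (p.getVert j) (p.getVert j), q.IsCycle ∧ q.edgeSet = p.edgeSet ∧
      q.length = p.length ∧ (∀ i, i + j ≤ p.length → q.getVert i = p.getVert (i + j)) ∧
      ∀ i, p.length ≤ i + j → i ≤ p.length → q.getVert i = p.getVert (i + j - p.length) := by
  have h1 : (p.drop j).length = p.length - j := p.drop_length j
  have h2 : (p.take j).length = j := by rw [p.take_length]; omega
  have hlen : ((p.drop j).append (p.take j)).length = p.length := by
    rw [Walk.length_append]; omega
  have hv1 : ∀ i, i + j ≤ p.length →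
      ((p.drop j).append (p.take j)).getVert i = p.getVert (i + j) := by
    intro i hi
    rw [Walk.getVert_append, h1]
    split_ifs with h
    · rw [p.drop_getVert, add_comm]
    · have : i + j = p.length := by omega
      rw [this, p.getVert_length, show i - (p.length - j) = 0 by omega, Walk.getVert_zero]
  have hv2 : ∀ i, p.length ≤ i + j → i ≤ p.length →
      ((p.drop j).append (p.take j)).getVert i = p.getVert (i + j - p.length) := by
    intro i hi hi'
    rw [Walk.getVert_append, h1, if_neg (by omega), p.take_getVert]
    congr 1; omega
  have hedge : ((p.drop j).append (p.take j)).edgeSet = p.edgeSet := by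
    rw [Walk.edgeSet_append, Set.union_comm, ← Walk.edgeSet_append, p.append_take_drop_eq j]
  refine ⟨_, ?_, hedge, hlen, hv1, hv2⟩
  classical
  have hsub : (p.take j).append (p.drop j) = p := p.append_take_drop_eq j
  have hp' := hp
  rw [Walk.isCycle_def] at hp ⊢
  refine ⟨?_, ?_, ?_⟩
  · have := hp.1
    rw [Walk.isTrail_def, ← hsub, Walk.edges_append] at this
    rw [Walk.isTrail_def, Walk.edges_append]
    exact (List.perm_append_comm.nodup_iff).mp this
  · intro h
    have h3 := congrArg Walk.length h
    rw [hlen] at h3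
    have h4 := hp'.three_le_length
    rw [Walk.length_nil] at h3; omega
  · have := hp.2.2
    rw [← hsub, Walk.tail_support_append] at this
    rw [Walk.tail_support_append]
    exact (List.perm_append_comm.nodup_iff).mp this

/-! ### Cycles through a given edge -/

lemma exists_cycle_of_not_isBridge {a b : V} (hadj : G.Adj a b) (h : ¬ G.IsBridge s(a, b)) :
    ∃ p : G.Walk a a, p.IsCycle ∧ p.getVert 1 = b := by
  classical
  rw [isBridge_iff, not_not] at h
  obtain ⟨q⟩ := h.symm
  have hle : G.deleteEdges {s(a, b)} ≤ G := deleteEdges_le _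
  refine ⟨Walk.cons hadj (q.toPath.1.mapLe hle), ?_, by simp⟩
  rw [Walk.cons_isCycle_iff]
  refine ⟨(Walk.isPath_mapLe hle).mpr q.toPath.2, fun hmem => ?_⟩
  rw [Walk.edges_mapLe_eq_edges] at hmem
  have := q.toPath.1.edges_subset_edgeSet hmem
  simp at this

/-- Placing the given edge last makes its freeness confine the active positions to an initial
segment of the labelling. -/
lemma exists_cycle_of_not_isBridge' {a b : V} (hadj : G.Adj a b) (h : ¬ G.IsBridge s(a, b)) :
    ∃ p : G.Walk a a, p.IsCycle ∧ p.getVert (p.length - 1) = b := by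
  obtain ⟨p, hp, hb⟩ := exists_cycle_of_not_isBridge hadj h
  refine ⟨p.reverse, hp.reverse, ?_⟩
  have := hp.three_le_length
  rw [p.getVert_reverse, Walk.length_reverse, show p.length - (p.length - 1) = 1 by omega, hb]

lemma Walk.IsCycle.not_isBridge {u : V} {p : G.Walk u u} (hp : p.IsCycle) {e : Sym2 V}
    (he : e ∈ p.edgeSet) : ¬ G.IsBridge e := fun h =>
  (isBridge_iff_forall_cycle_notMem (p.edges_subset_edgeSet he)).mp h _ hp he

lemma IsCactus.edgeSet_eq (hG : G.IsCactus) {u v : V} {p : G.Walk u u} {q : G.Walk v v}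
    (hp : p.IsCycle) (hq : q.IsCycle) {e : Sym2 V} (hep : e ∈ p.edgeSet) (heq : e ∈ q.edgeSet) :
    p.edgeSet = q.edgeSet := by
  by_contra h
  exact Set.disjoint_left.mp (hG.2 u v p q hp hq h) hep heq

/-! ### The gate of a vertex in a cycle -/

lemma reachable_getVert_of_subset {H : SimpleGraph V} {u v : V} (p : G.Walk u v) {i j : ℕ}
    (hij : i ≤ j) (hH : ∀ t, i ≤ t → t < j → H.Adj (p.getVert t) (p.getVert (t + 1))) :
    H.Reachable (p.getVert i) (p.getVert j) := by
  induction j, hij using Nat.le_induction with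
  | base => exact Reachable.refl _
  | succ j hij ih =>
    exact (ih fun t h1 h2 => hH t h1 (by omega)).trans (hH j hij (by omega)).reachable

/-- A path off the cycle from `v_i` to `v_j`, followed by the arc back to `v_{i+1}` and the edge
`v_i v_{i+1}`, gives a cycle that avoids `v_j v_{j+1}` but shares `v_i v_{i+1}` with `p`. -/
lemma IsCactus.not_reachable_getVert (hG : G.IsCactus) {u : V} {p : G.Walk u u} (hp : p.IsCycle)
    {i j : ℕ} (hij : i < j) (hj : j < p.length) :
    ¬ (G.deleteEdges p.edgeSet).Reachable (p.getVert i) (p.getVert j) := by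
  intro hr
  set e := s(p.getVert i, p.getVert (i + 1)) with he
  set f := s(p.getVert j, p.getVert (j + 1)) with hf
  have hep : e ∈ p.edgeSet := p.edge_getVert_mem (by omega)
  have hfp : f ∈ p.edgeSet := p.edge_getVert_mem hj
  have key : ∀ t t', t < p.length → t' < p.length → t ≠ t' →
      s(p.getVert t, p.getVert (t + 1)) ≠ s(p.getVert t', p.getVert (t' + 1)) := by
    intro t t' ht ht' hne h
    have h3 := hp.three_le_length
    have hs : ∀ r, r < p.length → (r + 1 < p.length ∧ p.getVert (r + 1) = p.getVert (r + 1)) ∨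
        (r + 1 = p.length ∧ p.getVert (r + 1) = p.getVert 0) := by
      intro r hr
      by_cases h : r + 1 < p.length
      · exact Or.inl ⟨h, rfl⟩
      · have : r + 1 = p.length := by omega
        exact Or.inr ⟨this, by rw [this, p.getVert_length, p.getVert_zero]⟩
    rcases Sym2.eq_iff.mp h with ⟨h1, -⟩ | ⟨h1, h2⟩
    · exact hne (hp.getVert_inj ht ht' h1)
    · rcases hs t ht with ⟨ha, -⟩ | ⟨ha, ha'⟩ <;> rcases hs t' ht' with ⟨hb, -⟩ | ⟨hb, hb'⟩
      · have := hp.getVert_inj ht hb h1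
        have := hp.getVert_inj ha ht' h2
        omega
      · rw [hb'] at h1
        have := hp.getVert_inj ht (by omega) h1
        have := hp.getVert_inj ha ht' h2
        omega
      · rw [ha'] at h2
        have := hp.getVert_inj ht hb h1
        have := hp.getVert_inj (by omega) ht' h2
        omega
      · omega
  have hef : e ≠ f := key i j (by omega) hj (by omega)
  have hadj : (G.deleteEdges {f}).Adj (p.getVert i) (p.getVert (i + 1)) := by
    rw [deleteEdges_adj]
    exact ⟨p.adj_getVert_succ (by omega), hef⟩
  have hnb : ¬ (G.deleteEdges {f}).IsBridge e := by
    rw [he, isBridge_iff, not_not, deleteEdges_deleteEdges]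
    have hle : G.deleteEdges p.edgeSet ≤ G.deleteEdges ({f} ∪ {s(p.getVert i, p.getVert (i + 1))}) :=
      deleteEdges_anti (by
        rintro x (rfl | rfl)
        · exact hfp
        · exact hep)
    refine (hr.mono hle).trans (Reachable.symm ?_)
    refine reachable_getVert_of_subset p (by omega) fun t h1 h2 => ?_
    rw [deleteEdges_adj]
    refine ⟨p.adj_getVert_succ (by omega), ?_⟩
    rintro (h | h)
    · exact key t j (by omega) hj (by omega) h
    · exact key t i (by omega) (by omega) (by omega) h
  obtain ⟨c, hc, hc1⟩ := exists_cycle_of_not_isBridge hadj hnb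
  have hle : G.deleteEdges {f} ≤ G := deleteEdges_le _
  have hc' : (c.mapLe hle).IsCycle := (Walk.isCycle_mapLe hle).mpr hc
  have hce : e ∈ (c.mapLe hle).edgeSet := by
    rw [Walk.edgeSet_mapLe_eq_edgeSet]
    have := c.edge_getVert_mem (i := 0) (by have := hc.three_le_length; omega)
    simpa [hc1] using this
  have hcf : f ∈ c.edgeSet := by
    rw [← Walk.edgeSet_mapLe_eq_edgeSet hle, hG.edgeSet_eq hc' hp hce hep]
    exact hfp
  have := c.edges_subset_edgeSet hcf
  simp at this

lemma Connected.exists_reachable_getVert (hG : G.Connected) {u : V} {p : G.Walk u u}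
    (hp : p.IsCycle) (x : V) :
    ∃ i < p.length, (G.deleteEdges p.edgeSet).Reachable (p.getVert i) x := by
  have h3 := hp.three_le_length
  obtain ⟨q⟩ := hG.preconnected x u
  induction q with
  | nil => exact ⟨0, by omega, by simp⟩
  | cons h q ih =>
    rename_i x y z
    by_cases he : s(x, y) ∈ p.edgeSet
    · have : x ∈ p.support := (Walk.mem_support_iff_mem_edgeSet hp x).mpr ⟨_, he, by simp⟩
      obtain ⟨i, hi, rfl⟩ := Walk.exists_getVert_lt hp this
      exact ⟨i, hi, Reachable.refl _⟩
    · obtain ⟨i, hi, hr⟩ := ih hp h3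
      refine ⟨i, hi, hr.trans (Adj.reachable ?_)⟩
      rw [deleteEdges_adj, Sym2.eq_swap]
      exact ⟨h.symm, he⟩

/-- The position of the vertex of the cycle `p` in the component of `x` in `G - E(p)`. -/
noncomputable def gateIdx {u : V} (p : G.Walk u u) (x : V) : ℕ :=
  sInf {i | (G.deleteEdges p.edgeSet).Reachable (p.getVert i) x}

section Gate

variable {u : V} {p : G.Walk u u}

lemma IsCactus.reachable_gateIdx (hG : G.IsCactus) (hp : p.IsCycle) (x : V) :
    (G.deleteEdges p.edgeSet).Reachable (p.getVert (gateIdx p x)) x := by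
  obtain ⟨i, -, hi⟩ := hG.1.exists_reachable_getVert hp x
  exact Nat.sInf_mem (s := {i | (G.deleteEdges p.edgeSet).Reachable (p.getVert i) x}) ⟨i, hi⟩

lemma IsCactus.gateIdx_lt (hG : G.IsCactus) (hp : p.IsCycle) (x : V) :
    gateIdx p x < p.length := by
  obtain ⟨i, hi, h⟩ := hG.1.exists_reachable_getVert hp x
  exact lt_of_le_of_lt (Nat.sInf_le (by exact h)) hi

lemma IsCactus.gateIdx_eq (hG : G.IsCactus) (hp : p.IsCycle) {x : V} {i : ℕ} (hi : i < p.length)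
    (h : (G.deleteEdges p.edgeSet).Reachable (p.getVert i) x) : gateIdx p x = i := by
  have h1 := hG.reachable_gateIdx hp x
  have h2 := hG.gateIdx_lt hp x
  rcases lt_trichotomy (gateIdx p x) i with h' | h' | h'
  · exact absurd (h1.trans h.symm) (hG.not_reachable_getVert hp h' hi)
  · exact h'
  · exact absurd (h.trans h1.symm) (hG.not_reachable_getVert hp h' h2)

lemma IsCactus.gateIdx_getVert (hG : G.IsCactus) (hp : p.IsCycle) {i : ℕ} (hi : i < p.length) :
    gateIdx p (p.getVert i) = i :=
  hG.gateIdx_eq hp hi (Reachable.refl _)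

lemma IsCactus.getVert_gateIdx (hG : G.IsCactus) (hp : p.IsCycle) {v : V} (hv : v ∈ p.support) :
    p.getVert (gateIdx p v) = v := by
  obtain ⟨i, hi, rfl⟩ := Walk.exists_getVert_lt hp hv
  rw [hG.gateIdx_getVert hp hi]

lemma IsCactus.gateIdx_eq_of_reachable (hG : G.IsCactus) (hp : p.IsCycle) {x y : V}
    (h : (G.deleteEdges p.edgeSet).Reachable x y) : gateIdx p x = gateIdx p y :=
  (hG.gateIdx_eq hp (hG.gateIdx_lt hp x) ((hG.reachable_gateIdx hp x).trans h)).symm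

lemma IsCactus.gateIdx_eq_of_adj (hG : G.IsCactus) (hp : p.IsCycle) {x y : V} (hadj : G.Adj x y)
    (h : s(x, y) ∉ p.edgeSet) : gateIdx p x = gateIdx p y :=
  hG.gateIdx_eq_of_reachable hp (Adj.reachable (by rw [deleteEdges_adj]; exact ⟨hadj, h⟩))

/-- The distance of positions `i` and `j` on a cycle of length `g`. -/
def cycDist (g i j : ℕ) : ℕ := min (i - j + (j - i)) (g - (i - j + (j - i)))

lemma Walk.dist_getVert_le_cycDist (p : G.Walk u u) {i j : ℕ} (hi : i ≤ p.length)
    (hj : j ≤ p.length) : G.dist (p.getVert i) (p.getVert j) ≤ cycDist p.length i j := by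
  wlog hij : i ≤ j generalizing i j
  · rw [dist_comm]
    have := this hj hi (by omega)
    simp only [cycDist] at *; omega
  refine le_min (dist_getVert_le p i j) ?_
  have h1 := G.dist_le ((p.drop j).append (p.take i))
  rw [Walk.length_append, p.drop_length, p.take_length, dist_comm] at h1
  omega

/-- The distance to a vertex of a cycle is realised through the gate. -/
lemma IsCactus.dist_getVert (hG : G.IsCactus) (hp : p.IsCycle) (s : V) {j : ℕ}
    (hj : j ≤ p.length) :
    G.dist s (p.getVert j) =
      G.dist s (p.getVert (gateIdx p s)) + cycDist p.length (gateIdx p s) j := by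
  have h3 := hp.three_le_length
  have hs := hG.gateIdx_lt hp s
  apply le_antisymm
  · exact hG.1.dist_triangle.trans
      (Nat.add_le_add_left (p.dist_getVert_le_cycDist hs.le hj) _)
  · classical
    -- The true distance inside the component of `s`, the claimed formula elsewhere; the two agree
    -- at the gate of `s`, so `F` grows by at most one along every edge.
    let F : V → ℕ := fun z => if gateIdx p z = gateIdx p s then G.dist s z else
      G.dist s (p.getVert (gateIdx p s)) + cycDist p.length (gateIdx p s) (gateIdx p z)
    have hC : ∀ i, i ≤ p.length → F (p.getVert i) =
        G.dist s (p.getVert (gateIdx p s)) + cycDist p.length (gateIdx p s) i := by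
      intro i hi
      have aux : ∀ i, i < p.length → F (p.getVert i) =
          G.dist s (p.getVert (gateIdx p s)) + cycDist p.length (gateIdx p s) i := by
        intro i hi
        simp only [F, hG.gateIdx_getVert hp hi]
        split_ifs with h
        · subst h; simp [cycDist]
        · rfl
      rcases hi.lt_or_eq with h | h
      · exact aux i h
      · have := aux 0 (by omega)
        rw [p.getVert_zero] at this
        rw [h, p.getVert_length, this]
        simp only [cycDist]; omega
    have hF : ∀ z z', G.Adj z z' → F z' ≤ F z + 1 := by
      intro z z' hadj
      by_cases he : s(z, z') ∈ p.edgeSet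
      · obtain ⟨i, hi, h⟩ := (p.mem_edgeSet_iff_getVert _).mp he
        rcases Sym2.eq_iff.mp h with ⟨rfl, rfl⟩ | ⟨rfl, rfl⟩ <;>
        · rw [hC _ hi.le, hC _ (by omega)]
          simp only [cycDist]; omega
      · have := hG.gateIdx_eq_of_adj hp hadj he
        simp only [F, this]
        split_ifs
        · exact hG.1.dist_le_dist_add_one s hadj
        · omega
    have := hG.1.apply_le_apply_add_dist hF s (p.getVert j)
    rw [hC j hj] at this
    simpa [F] using this

lemma IsCactus.dist_getVert_getVert (hG : G.IsCactus) (hp : p.IsCycle) {i j : ℕ}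
    (hi : i < p.length) (hj : j ≤ p.length) :
    G.dist (p.getVert i) (p.getVert j) = cycDist p.length i j := by
  have := hG.dist_getVert hp (p.getVert i) hj
  rw [hG.gateIdx_getVert hp hi] at this
  simpa using this

/-- Paths between vertices with distinct gates pass through the gates. -/
lemma IsCactus.dist_eq_of_gateIdx_ne (hG : G.IsCactus) (hp : p.IsCycle) {s x : V}
    (h : gateIdx p s ≠ gateIdx p x) :
    G.dist s x = G.dist s (p.getVert (gateIdx p x)) + G.dist (p.getVert (gateIdx p x)) x := by
  apply le_antisymm hG.1.dist_triangle
  classical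
  have hx := hG.gateIdx_lt hp x
  -- Only inside the component of `x` is the distance replaced by the route through the gate, so on
  -- the cycle `F` is still the distance from `s`.
  let F : V → ℕ := fun z => if gateIdx p z = gateIdx p x then
    G.dist s (p.getVert (gateIdx p x)) + G.dist (p.getVert (gateIdx p x)) z else G.dist s z
  have hC : ∀ i, i ≤ p.length → F (p.getVert i) = G.dist s (p.getVert i) := by
    have aux : ∀ i, i < p.length → F (p.getVert i) = G.dist s (p.getVert i) := by
      intro i hi
      simp only [F, hG.gateIdx_getVert hp hi]
      split_ifs with h
      · subst h; simp
      · rfl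
    intro i hi
    rcases hi.lt_or_eq with h | h
    · exact aux i h
    · have := aux 0 (by omega)
      rw [p.getVert_zero] at this
      rw [h, p.getVert_length, this]
  have hF : ∀ z z', G.Adj z z' → F z' ≤ F z + 1 := by
    intro z z' hadj
    by_cases he : s(z, z') ∈ p.edgeSet
    · have hd := hG.1.dist_le_dist_add_one s hadj
      obtain ⟨i, hi, h⟩ := (p.mem_edgeSet_iff_getVert _).mp he
      rcases Sym2.eq_iff.mp h with ⟨rfl, rfl⟩ | ⟨rfl, rfl⟩ <;>
        rwa [hC _ hi.le, hC _ (by omega)]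
    · have := hG.gateIdx_eq_of_adj hp hadj he
      simp only [F, this]
      split_ifs
      · have := hG.1.dist_le_dist_add_one (p.getVert (gateIdx p x)) hadj
        omega
      · exact hG.1.dist_le_dist_add_one s hadj
  have := hG.1.apply_le_apply_add_dist hF s x
  simpa [F, h] using this

end Gate

end SimpleGraph

namespace SimpleGraph

variable {V : Type*} {G : SimpleGraph V} {S : Set V}

/-! ### Active vertices -/

section Active

variable {u : V} {p : G.Walk u u}

lemma activeSet_eq_of_edgeSet_eq {w : V} {q : G.Walk w w} (hp : p.IsCycle) (hq : q.IsCycle)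
    (h : q.edgeSet = p.edgeSet) : G.activeSet S q = G.activeSet S p := by
  ext v
  simp only [activeSet, Set.mem_ofPred_eq, Walk.mem_support_iff_mem_edgeSet hp,
    Walk.mem_support_iff_mem_edgeSet hq, h]

lemma IsCactus.getVert_mem_activeSet_iff (hG : G.IsCactus) (hp : p.IsCycle) {i : ℕ}
    (hi : i < p.length) : p.getVert i ∈ G.activeSet S p ↔ ∃ s ∈ S, gateIdx p s = i := by
  constructor
  · rintro ⟨-, s, hs, hr⟩
    exact ⟨s, hs, hG.gateIdx_eq hp hi hr⟩
  · rintro ⟨s, hs, rfl⟩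
    exact ⟨p.getVert_mem_support _, s, hs, hG.reachable_gateIdx hp s⟩

lemma IsCactus.getVert_gateIdx_mem_activeSet (hG : G.IsCactus) (hp : p.IsCycle) {s : V}
    (hs : s ∈ S) : p.getVert (gateIdx p s) ∈ G.activeSet S p :=
  (hG.getVert_mem_activeSet_iff hp (hG.gateIdx_lt hp s)).mpr ⟨s, hs, rfl⟩

/-- The form in which biactivity is used throughout. -/
lemma IsCactus.exists_gateIdx_ne (hG : G.IsCactus) (hbi : G.IsBiactive S) (hp : p.IsCycle)
    (i : ℕ) : ∃ s ∈ S, gateIdx p s ≠ i := by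
  by_contra! h
  have h2 := hbi u p hp
  have : G.activeSet S p ⊆ {p.getVert i} := by
    rintro v ⟨hv, s, hs, hr⟩
    obtain ⟨j, hj, rfl⟩ := Walk.exists_getVert_lt hp hv
    rw [Set.mem_singleton_iff, ← h s hs, hG.gateIdx_eq hp hj hr]
  have := (Set.encard_le_encard this).trans_eq (Set.encard_singleton _)
  exact absurd (h2.trans this) (by norm_num)

lemma le_lastActive {i : ℕ} (hi : i < p.length) (h : p.getVert i ∈ G.activeSet S p) :
    i ≤ G.lastActive S p :=
  le_csSup ⟨p.length, fun _ hj => hj.1.le⟩ ⟨hi, h⟩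

lemma lastActive_spec (hp : p.IsCycle) (h : (G.activeSet S p).Nonempty) :
    G.lastActive S p < p.length ∧ p.getVert (G.lastActive S p) ∈ G.activeSet S p := by
  obtain ⟨v, hv⟩ := h
  obtain ⟨i, hi, rfl⟩ := Walk.exists_getVert_lt hp hv.1
  exact Nat.sSup_mem (s := {i | i < p.length ∧ p.getVert i ∈ G.activeSet S p}) ⟨i, hi, hv⟩
    ⟨p.length, fun _ hj => hj.1.le⟩

lemma IsCactus.gateIdx_le_lastActive (hG : G.IsCactus) (hp : p.IsCycle) {s : V} (hs : s ∈ S) :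
    gateIdx p s ≤ G.lastActive S p :=
  le_lastActive (hG.gateIdx_lt hp s) (hG.getVert_gateIdx_mem_activeSet hp hs)

lemma lastActive_le {k : ℕ} (hp : p.IsCycle) (h : (G.activeSet S p).Nonempty)
    (hk : ∀ i < p.length, p.getVert i ∈ G.activeSet S p → i ≤ k) : G.lastActive S p ≤ k :=
  hk _ (lastActive_spec hp h).1 (lastActive_spec hp h).2

/-- A labelling from an active vertex whose active vertices lie within half of the cycle is
canonical. -/
lemma IsCactus.isCanonicalCycle (hG : G.IsCactus) (hp : p.IsCycle) (hu : u ∈ G.activeSet S p)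
    (hk : 2 * G.lastActive S p ≤ p.length) : G.IsCanonicalCycle S p := by
  refine ⟨hp, hu, fun w q hq hqp _ => ?_⟩
  have hact := activeSet_eq_of_edgeSet_eq (S := S) hp hq hqp
  obtain ⟨hk1, hk2⟩ := lastActive_spec hp ⟨u, hu⟩
  have h3 := hp.three_le_length
  -- As `2k ≤ g`, the active vertices `v_0` and `v_k` are at distance `k`, so their indices differ
  -- by at least `k` in any labelling.
  have hd := hG.dist_getVert_getVert hp (i := 0) (by omega) hk1.le
  rw [p.getVert_zero] at hd
  rw [← hact] at hu hk2
  obtain ⟨i, hi, hi'⟩ := Walk.exists_getVert_lt hq hu.1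
  obtain ⟨j, hj, hj'⟩ := Walk.exists_getVert_lt hq hk2.1
  have h1 := le_lastActive hi (by rwa [hi'])
  have h2 := le_lastActive hj (by rwa [hj'])
  have := dist_getVert_le q i j
  rw [hi', hj', hd] at this
  simp only [cycDist] at this
  omega

end Active

/-! ### Bridges -/

section Bridge

variable {a b : V}

lemma Connected.reachable_or_reachable (hG : G.Connected) (a b y : V) :
    (G.deleteEdges {s(a, b)}).Reachable a y ∨ (G.deleteEdges {s(a, b)}).Reachable b y := by
  obtain ⟨q⟩ := hG.preconnected y a
  induction q with
  | nil => exact Or.inl (Reachable.refl _)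
  | cons h q ih =>
    rename_i x z a
    by_cases he : s(x, z) = s(a, b)
    · rcases Sym2.eq_iff.mp he with ⟨rfl, -⟩ | ⟨rfl, -⟩
      · exact Or.inl (Reachable.refl _)
      · exact Or.inr (Reachable.refl _)
    · have : (G.deleteEdges {s(a, b)}).Reachable z x := by
        refine Adj.reachable ?_
        rw [deleteEdges_adj]
        exact ⟨h.symm, fun h' => he (by rw [Sym2.eq_swap]; exact h')⟩
      exact ih.imp (fun h => h.trans this) fun h => h.trans this

lemma Connected.dist_of_reachable_of_reachable (hG : G.Connected) (hadj : G.Adj a b)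
    (hb : G.IsBridge s(a, b)) {s x : V} (hs : (G.deleteEdges {s(a, b)}).Reachable a s)
    (hx : (G.deleteEdges {s(a, b)}).Reachable b x) :
    G.dist s x = G.dist s a + 1 + G.dist b x := by
  apply le_antisymm
  · have h1 := hG.dist_triangle (u := s) (v := a) (w := x)
    have h2 := hG.dist_triangle (u := a) (v := b) (w := x)
    rw [dist_eq_one_iff_adj.mpr hadj] at h2
    omega
  classical
  have hnb : ∀ z, (G.deleteEdges {s(a, b)}).Reachable a z →
      ¬ (G.deleteEdges {s(a, b)}).Reachable b z := fun z h1 h2 =>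
    isBridge_iff.mp hb (h1.trans h2.symm)
  let F : V → ℕ := fun z => if (G.deleteEdges {s(a, b)}).Reachable a z then G.dist s z else
    G.dist s a + 1 + G.dist b z
  have hFa : F a = G.dist s a := if_pos (Reachable.refl _)
  have hFb : F b = G.dist s a + 1 := by
    simp only [F, if_neg fun h => hnb b h (Reachable.refl _)]; simp
  have hF : ∀ z z', G.Adj z z' → F z' ≤ F z + 1 := by
    intro z z' h
    by_cases he : s(z, z') = s(a, b)
    · rcases Sym2.eq_iff.mp he with ⟨rfl, rfl⟩ | ⟨rfl, rfl⟩ <;> omega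
    · have hr : (G.deleteEdges {s(a, b)}).Adj z z' := by
        rw [deleteEdges_adj]; exact ⟨h, he⟩
      have : (G.deleteEdges {s(a, b)}).Reachable a z ↔
          (G.deleteEdges {s(a, b)}).Reachable a z' :=
        ⟨fun h => h.trans hr.reachable, fun h => h.trans hr.symm.reachable⟩
      simp only [F, this]
      split_ifs
      · exact hG.dist_le_dist_add_one s h
      · have := hG.dist_le_dist_add_one b h
        omega
  have := hG.apply_le_apply_add_dist hF s x
  have hnx : ¬ (G.deleteEdges {s(a, b)}).Reachable a x := fun h => hnb x h hx
  simpa [F, hs, hnx] using this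

lemma Connected.dist_of_reachable_right (hG : G.Connected) (hadj : G.Adj a b)
    (hb : G.IsBridge s(a, b)) {x : V} (hx : (G.deleteEdges {s(a, b)}).Reachable b x) :
    G.dist x a = G.dist x b + 1 := by
  have := hG.dist_of_reachable_of_reachable hadj hb (Reachable.refl a) hx
  rw [dist_self] at this
  rw [dist_comm, this, dist_comm]
  omega

lemma Connected.dist_of_reachable_left (hG : G.Connected) (hadj : G.Adj a b)
    (hb : G.IsBridge s(a, b)) {x : V} (hx : (G.deleteEdges {s(a, b)}).Reachable a x) :
    G.dist x b = G.dist x a + 1 := by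
  simpa using hG.dist_of_reachable_of_reachable hadj hb hx (Reachable.refl b)

lemma Connected.reachable_right_of_dist (hG : G.Connected) (hadj : G.Adj a b)
    (hb : G.IsBridge s(a, b)) {x : V} (hx : G.dist x b ≤ G.dist x a) :
    (G.deleteEdges {s(a, b)}).Reachable b x := by
  refine (hG.reachable_or_reachable a b x).resolve_left fun h => ?_
  have := hG.dist_of_reachable_left hadj hb h
  omega

/-- Distances across a bridge, with the sides given by distances. -/
lemma Connected.dist_across_bridge (hG : G.Connected) (hadj : G.Adj a b)
    (hb : G.IsBridge s(a, b)) {s x : V} (hs : G.dist s a ≤ G.dist s b)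
    (hx : G.dist x b ≤ G.dist x a) : G.dist s x = G.dist s a + 1 + G.dist b x := by
  refine hG.dist_of_reachable_of_reachable hadj hb ?_ (hG.reachable_right_of_dist hadj hb hx)
  have := hG.reachable_right_of_dist hadj.symm (by rwa [Sym2.eq_swap]) hs
  rwa [Sym2.eq_swap] at this

lemma Connected.dist_bridge_cases (hG : G.Connected) (hadj : G.Adj a b)
    (hb : G.IsBridge s(a, b)) (x : V) :
    G.dist x b = G.dist x a + 1 ∨ G.dist x a = G.dist x b + 1 :=
  (hG.reachable_or_reachable a b x).imp (hG.dist_of_reachable_left hadj hb)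
    (hG.dist_of_reachable_right hadj hb)

/-- A cycle meets only one side of a bridge. -/
lemma Walk.IsCycle.reachable_of_bridge {u : V} {p : G.Walk u u} (hp : p.IsCycle)
    (hb : G.IsBridge s(a, b)) {x y : V} (hx : x ∈ p.support) (hy : y ∈ p.support) :
    (G.deleteEdges {s(a, b)}).Reachable x y := by
  have key : ∀ i ≤ p.length, (G.deleteEdges {s(a, b)}).Reachable (p.getVert 0) (p.getVert i) :=
    fun i hi => reachable_getVert_of_subset p (Nat.zero_le _) fun t _ ht => by
      rw [deleteEdges_adj]
      refine ⟨p.adj_getVert_succ (by omega), fun h => ?_⟩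
      exact hp.not_isBridge (p.edge_getVert_mem (i := t) (by omega)) (by rwa [h])
  obtain ⟨i, hi, rfl⟩ := Walk.exists_getVert_lt hp hx
  obtain ⟨j, hj, rfl⟩ := Walk.exists_getVert_lt hp hy
  exact (key i hi.le).symm.trans (key j hj.le)

/-- A side of a bridge without vertices of `S` contains no cycle. -/
lemma IsCactus.not_reachable_of_side_free (hG : G.IsCactus) (hbi : G.IsBiactive S)
    (hb : G.IsBridge s(a, b))
    (hfree : ∀ y, (G.deleteEdges {s(a, b)}).Reachable b y → y ∉ S)
    {u : V} {p : G.Walk u u} (hp : p.IsCycle) {x : V} (hx : x ∈ p.support) :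
    ¬ (G.deleteEdges {s(a, b)}).Reachable b x := by
  intro hbx
  obtain ⟨s, hs, hne⟩ := hG.exists_gateIdx_ne hbi hp (gateIdx p a)
  apply hne
  have hr : (G.deleteEdges {s(a, b)}).Reachable a s :=
    (hG.1.reachable_or_reachable a b s).resolve_right fun h => hfree s h hs
  obtain ⟨q⟩ := hr
  -- The cycle lies on the side of `b`, so a walk on the side of `a` never uses a cycle edge. Hence
  -- all of `S` shares the gate of `a`, against biactivity.
  have : ∀ {z t : V} (q : (G.deleteEdges {s(a, b)}).Walk z t),
      (G.deleteEdges {s(a, b)}).Reachable a z → gateIdx p t = gateIdx p z := by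
    intro z t q
    induction q with
    | nil => exact fun _ => rfl
    | cons h q ih =>
      intro hz
      rw [ih (hz.trans h.reachable)]
      refine (hG.gateIdx_eq_of_adj hp (deleteEdges_le _ h) fun he => ?_).symm
      rename_i z z' t
      have hz' : z ∈ p.support := (Walk.mem_support_iff_mem_edgeSet hp z).mpr ⟨_, he, by simp⟩
      exact isBridge_iff.mp hb
        (hz.trans ((hp.reachable_of_bridge hb hx hz').symm.trans hbx.symm))
  exact this q (Reachable.refl _)

end Bridge

end SimpleGraph

namespace SimpleGraph

variable {V : Type*} {G : SimpleGraph V} {S : Set V}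

/-! ### Threads -/

lemma Walk.IsCycle.exists_two_neighbors {u : V} {p : G.Walk u u} (hp : p.IsCycle) {x : V}
    (hx : x ∈ p.support) :
    ∃ y z, y ≠ z ∧ s(x, y) ∈ p.edgeSet ∧ s(x, z) ∈ p.edgeSet := by
  obtain ⟨i, hi, rfl⟩ := Walk.exists_getVert_lt hp hx
  obtain ⟨q, hq, hqe, -, -, -⟩ := hp.exists_rotate hi.le
  have h3 := hq.three_le_length
  refine ⟨q.getVert 1, q.getVert (q.length - 1), fun h => ?_, ?_, ?_⟩
  · have := hq.getVert_inj (by omega) (by omega) h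
    omega
  · rw [← hqe]
    simpa using q.edge_getVert_mem (i := 0) (by omega)
  · rw [← hqe]
    have := q.edge_getVert_mem (i := q.length - 1) (by omega)
    rwa [show q.length - 1 + 1 = q.length by omega, q.getVert_length, Sym2.eq_swap] at this

section Degree

variable [G.LocallyFinite]

lemma three_le_degree {v x y z : V} (hx : G.Adj v x) (hy : G.Adj v y) (hz : G.Adj v z)
    (hxy : x ≠ y) (hxz : x ≠ z) (hyz : y ≠ z) : 3 ≤ G.degree v := by
  classical
  have : ({x, y, z} : Finset V) ⊆ G.neighborFinset v := by
    intro t ht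
    simp only [Finset.mem_insert, Finset.mem_singleton] at ht
    rcases ht with rfl | rfl | rfl <;> simpa
  have h := Finset.card_le_card this
  rwa [Finset.card_eq_three.mpr ⟨x, y, z, hxy, hxz, hyz, rfl⟩, card_neighborFinset_eq_degree] at h

lemma degree_eq_two {v x y : V} (hx : G.Adj v x) (hy : G.Adj v y) (hxy : x ≠ y)
    (h : ∀ z, G.Adj v z → z = x ∨ z = y) : G.degree v = 2 := by
  classical
  rw [← card_neighborFinset_eq_degree, Finset.card_eq_two]
  refine ⟨x, y, hxy, ?_⟩
  ext z
  simp only [mem_neighborFinset, Finset.mem_insert, Finset.mem_singleton]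
  exact ⟨h z, by rintro (rfl | rfl) <;> assumption⟩

lemma degree_eq_one {v x : V} (hx : G.Adj v x) (h : ∀ z, G.Adj v z → z = x) :
    G.degree v = 1 := by
  classical
  rw [← card_neighborFinset_eq_degree, Finset.card_eq_one]
  refine ⟨x, ?_⟩
  ext z
  simp only [mem_neighborFinset, Finset.mem_singleton]
  exact ⟨h z, by rintro rfl; assumption⟩

lemma eq_or_eq_of_degree_eq_two {v x y z : V} (h : G.degree v = 2) (hx : G.Adj v x)
    (hy : G.Adj v y) (hxy : x ≠ y) (hz : G.Adj v z) : z = x ∨ z = y := by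
  by_contra! hne
  have := three_le_degree hx hy hz hxy hne.1.symm hne.2.symm
  omega

lemma eq_of_degree_eq_one {v x y : V} (h : G.degree v = 1) (hx : G.Adj v x)
    (hy : G.Adj v y) : x = y := by
  classical
  by_contra hne
  have : ({x, y} : Finset V) ⊆ G.neighborFinset v := by
    intro t ht
    simp only [Finset.mem_insert, Finset.mem_singleton] at ht
    rcases ht with rfl | rfl <;> simpa
  have h := Finset.card_le_card this
  rw [Finset.card_pair hne, card_neighborFinset_eq_degree] at h
  omega

/-- The side of `b` of the bridge `ab` is a path from a leaf to `b` with vertex list `l`. -/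
structure IsPathSide (G : SimpleGraph V) [G.LocallyFinite] (a b : V) (l : List V) : Prop where
  isChain : l.IsChain G.Adj
  nodup : l.Nodup
  head : ∃ u ∈ l.head?, G.degree u = 1
  tail : ∀ u ∈ l.tail, G.degree u = 2
  last : b ∈ l.getLast?
  side : ∀ u ∈ l, (G.deleteEdges {s(a, b)}).Reachable b u
  degree_le : ∀ y, (G.deleteEdges {s(a, b)}).Reachable b y → G.degree y ≤ 2
  dist_le : ∀ y, (G.deleteEdges {s(a, b)}).Reachable b y → G.dist a y ≤ l.length
  dist_inj : ∀ y z, (G.deleteEdges {s(a, b)}).Reachable b y →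
    (G.deleteEdges {s(a, b)}).Reachable b z → G.dist a y = G.dist a z → y = z

lemma IsPathSide.isFreeThread {a b : V} {l : List V} (h : G.IsPathSide a b l) (hadj : G.Adj a b)
    (hdeg : 3 ≤ G.degree a) (hfree : ∀ y, (G.deleteEdges {s(a, b)}).Reachable b y → y ∉ S) :
    G.IsFreeThread S a l :=
  ⟨⟨hdeg, h.isChain, h.nodup, h.head, h.tail, b, h.last, hadj.symm⟩,
    fun u hu => hfree u (h.side u hu)⟩

/-- A side of a bridge without vertices of `S` is a path. -/
lemma IsCactus.exists_isPathSide [Finite V] (hG : G.IsCactus) (hbi : G.IsBiactive S)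
    (hbr : G.IsBranchResolving S) {a b : V} (hadj : G.Adj a b) (hb : G.IsBridge s(a, b))
    (hfree : ∀ y, (G.deleteEdges {s(a, b)}).Reachable b y → y ∉ S) :
    ∃ l, G.IsPathSide a b l := by
  -- Induction on the size of the side. It contains no cycle, so every further edge at `b` is a
  -- bridge with a smaller free side; two such edges would start two free threads at `b`.
  induction hn : {y | (G.deleteEdges {s(a, b)}).Reachable b y}.ncard using Nat.strong_induction_on
    generalizing a b with
  | _ n ih =>
  have hbb : (G.deleteEdges {s(a, b)}).Reachable b b := Reachable.refl _
  have step : ∀ y, (G.deleteEdges {s(a, b)}).Reachable b y → y ≠ b →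
      ∃ c, G.Adj b c ∧ c ≠ a ∧ G.dist c y + 1 = G.dist b y := by
    intro y hy hyb
    obtain ⟨c, hc, hcy⟩ := hG.1.exists_adj_dist_add_one hyb.symm
    refine ⟨c, hc, ?_, hcy⟩
    rintro rfl
    have := hG.1.dist_of_reachable_right hadj hb hy
    rw [dist_comm, dist_comm (v := b)] at this
    omega
  have hda : ∀ y, (G.deleteEdges {s(a, b)}).Reachable b y → G.dist a y = G.dist b y + 1 := by
    intro y hy
    rw [dist_comm, hG.1.dist_of_reachable_right hadj hb hy, dist_comm]
  have key : ∀ c, G.Adj b c → c ≠ a → G.IsBridge s(b, c) ∧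
      (∀ y, (G.deleteEdges {s(b, c)}).Reachable c y →
        (G.deleteEdges {s(a, b)}).Reachable b y) ∧ ∃ l, G.IsPathSide b c l := by
    intro c hbc hca
    have hrc : (G.deleteEdges {s(a, b)}).Reachable b c := by
      refine Adj.reachable ?_
      rw [deleteEdges_adj]
      refine ⟨hbc, fun h => ?_⟩
      rcases Sym2.eq_iff.mp h with ⟨h1, -⟩ | ⟨-, h1⟩
      · exact hadj.ne h1.symm
      · exact hca h1
    have hbr' : G.IsBridge s(b, c) := by
      by_contra hnb
      obtain ⟨p, hp, -⟩ := exists_cycle_of_not_isBridge hbc hnb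
      exact hG.not_reachable_of_side_free hbi hb hfree hp p.start_mem_support hbb
    have hsub : ∀ y, (G.deleteEdges {s(b, c)}).Reachable c y →
        (G.deleteEdges {s(a, b)}).Reachable b y := by
      intro y hy
      refine (hG.1.reachable_or_reachable a b y).resolve_left fun hay => ?_
      have h1 := hG.1.dist_of_reachable_right hbc hbr' hy
      have h2 := hG.1.dist_of_reachable_of_reachable hadj hb hay hrc
      have h3 := hG.1.dist_of_reachable_left hadj hb hay
      omega
    refine ⟨hbr', hsub, ?_⟩
    refine ih _ ?_ hbc hbr' (fun y hy => hfree y (hsub y hy)) rfl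
    rw [← hn]
    apply Set.ncard_lt_ncard _ (Set.toFinite _)
    refine ⟨fun y hy => hsub y hy, fun h => ?_⟩
    exact isBridge_iff.mp hbr' (Reachable.symm (h hbb))
  by_cases hc : ∃ c, G.Adj b c ∧ c ≠ a
  · obtain ⟨c, hbc, hca⟩ := hc
    obtain ⟨hbr', hsub, l, hl⟩ := key c hbc hca
    have honly : ∀ z, G.Adj b z → z = a ∨ z = c := by
      by_contra! hz
      obtain ⟨z, hbz, hza, hzc⟩ := hz
      obtain ⟨hbr'', hsub', l', hl'⟩ := key z hbz hza
      have hdeg : 3 ≤ G.degree b := three_le_degree hadj.symm hbc hbz hca.symm hza.symm hzc.symm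
      have h1 := hl.isFreeThread hbc hdeg fun y hy => hfree y (hsub y hy)
      have h2 := hl'.isFreeThread hbz hdeg fun y hy => hfree y (hsub' y hy)
      have h3 := hl.last
      rw [hbr b l l' h1 h2] at h3
      exact hzc (Option.mem_unique hl'.last h3)
    have hdeg : G.degree b = 2 := degree_eq_two hadj.symm hbc hca.symm honly
    have hside : ∀ y, (G.deleteEdges {s(a, b)}).Reachable b y → y ≠ b →
        (G.deleteEdges {s(b, c)}).Reachable c y := by
      intro y hy hyb
      obtain ⟨c', hbc', hc'a, hd⟩ := step y hy hyb
      obtain rfl := (honly c' hbc').resolve_left hc'a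
      refine hG.1.reachable_right_of_dist hbc hbr' ?_
      rw [dist_comm, dist_comm (v := b)]
      omega
    have hlne : l ≠ [] := by
      rintro rfl
      simpa using hl.last
    refine ⟨l ++ [b], ?_, ?_, ?_, ?_, ?_, ?_, ?_, ?_, ?_⟩
    · rw [List.isChain_append]
      refine ⟨hl.isChain, by simp, fun x hx y hy => ?_⟩
      obtain rfl := Option.mem_unique hl.last hx
      simp only [List.head?_cons, Option.mem_def, Option.some.injEq] at hy
      subst hy
      exact hbc.symm
    · rw [List.nodup_append]
      refine ⟨hl.nodup, by simp, ?_⟩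
      intro x hx y hy hxy
      rw [List.mem_singleton] at hy
      subst hy hxy
      exact isBridge_iff.mp hbr' (hl.side x hx).symm
    · rw [List.head?_append_of_ne_nil _ hlne]
      exact hl.head
    · intro x hx
      rw [List.tail_append_of_ne_nil hlne, List.mem_append, List.mem_singleton] at hx
      rcases hx with hx | rfl
      · exact hl.tail x hx
      · exact hdeg
    · simp
    · intro x hx
      rw [List.mem_append, List.mem_singleton] at hx
      rcases hx with hx | rfl
      · exact hsub x (hl.side x hx)
      · exact hbb
    · intro y hy
      by_cases hyb : y = b
      · rw [hyb, hdeg]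
      · exact hl.degree_le y (hside y hy hyb)
    · intro y hy
      rw [hda y hy, List.length_append]
      by_cases hyb : y = b
      · simp [hyb]
      · simpa using hl.dist_le y (hside y hy hyb)
    · intro y z hy hz hyz
      rw [hda y hy, hda z hz] at hyz
      by_cases hyb : y = b
      · subst hyb
        rw [dist_self] at hyz
        exact hG.1.dist_eq_zero_iff.mp (by omega)
      · by_cases hzb : z = b
        · subst hzb
          rw [dist_self] at hyz
          exact (hG.1.dist_eq_zero_iff.mp (by omega)).symm
        · exact hl.dist_inj y z (hside y hy hyb) (hside z hz hzb) (by omega)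
  · push Not at hc
    have hside : ∀ y, (G.deleteEdges {s(a, b)}).Reachable b y → y = b := by
      intro y hy
      by_contra hyb
      obtain ⟨c, h1, h2, -⟩ := step y hy hyb
      exact h2 (hc c h1)
    have hdeg : G.degree b = 1 := degree_eq_one hadj.symm hc
    refine ⟨[b], by simp, by simp, ⟨b, by simp, hdeg⟩, by simp, by simp, ?_, ?_, ?_, ?_⟩
    · simp
    · intro y hy
      rw [hside y hy]; omega
    · intro y hy
      rw [hside y hy]; simp [dist_eq_one_iff_adj.mpr hadj]
    · intro y z hy hz _
      rw [hside y hy, hside z hz]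

/-- The vertices `f 0 = v, f 1, …, f m` of a thread of length `m` hanging at `v`, in the order of
their distance to `v`. -/
lemma IsThread.exists_spine {v : V} {l : List V} (h : G.IsThread v l) :
    ∃ f : ℕ → V, f 0 = v ∧ 1 ≤ l.length ∧ (∀ t, 1 ≤ t → t ≤ l.length → f t ∈ l) ∧
      (∀ t < l.length, G.Adj (f t) (f (t + 1))) ∧
      ∀ t, 1 ≤ t → t ≤ l.length → ∀ y, G.Adj (f t) y →
        y = f (t - 1) ∨ (t < l.length ∧ y = f (t + 1)) := by
  obtain ⟨hv, hchain, hnd, ⟨x, hx, hx1⟩, htail, z, hz, hzv⟩ := h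
  have hlne : l ≠ [] := by rintro rfl; simp at hx
  have hm : 1 ≤ l.length := List.length_pos_iff.mpr hlne
  let f : ℕ → V := fun t => if t = 0 then v else l.getD (l.length - t) v
  have hf : ∀ t, (h1 : 1 ≤ t) → (ht : t ≤ l.length) →
      f t = l[l.length - t]'(by omega) := by
    intro t h1 h2
    simp only [f, if_neg (show t ≠ 0 by omega)]
    rw [List.getD_eq_getElem]
  have hmem : ∀ t, 1 ≤ t → t ≤ l.length → f t ∈ l := by
    intro t h1 h2
    rw [hf t h1 h2]
    exact List.getElem_mem _
  have hadj : ∀ t < l.length, G.Adj (f t) (f (t + 1)) := by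
    intro t ht
    rcases Nat.eq_zero_or_pos t with rfl | h0
    · rw [zero_add, hf 1 le_rfl hm]
      have : f 0 = v := by simp [f]
      rw [this]
      rw [List.getLast?_eq_some_getLast hlne, Option.mem_some_iff,
        List.getLast_eq_getElem] at hz
      rw [hz]
      exact hzv.symm
    · rw [hf t h0 ht.le, hf (t + 1) (by omega) ht]
      have := List.isChain_iff_getElem.mp hchain (l.length - (t + 1)) (by omega)
      have e : l.length - (t + 1) + 1 = l.length - t := by omega
      simp only [e] at this
      exact this.symm
  refine ⟨f, by simp [f], hm, hmem, hadj, ?_⟩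
  intro t h1 h2 y hy
  have hprev : G.Adj (f t) (f (t - 1)) := by
    have := hadj (t - 1) (by omega)
    rw [show t - 1 + 1 = t by omega] at this
    exact this.symm
  rcases h2.lt_or_eq with hlt | heq
  · have hd : G.degree (f t) = 2 := by
      apply htail
      rw [hf t h1 h2]
      have : l[l.length - t] = l.tail[l.length - t - 1]'(by simp; omega) := by
        rw [List.getElem_tail]
        congr 1; omega
      rw [this]
      exact List.getElem_mem _
    -- Beyond distinctness in the list, only `t = 1` needs care: `f 0 = v` has degree at least 3, so
    -- it is not in the thread.
    have hne : f (t - 1) ≠ f (t + 1) := by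
      intro he
      rcases Nat.eq_zero_or_pos (t - 1) with h0 | h0
      · rw [h0] at he
        have hmem' := hmem (t + 1) (by omega) hlt
        rw [← he] at hmem'
        simp only [f, if_true] at hmem'
        obtain ⟨l', rfl⟩ : ∃ l', l = x :: l' := by
          cases l with
          | nil => exact absurd rfl hlne
          | cons x' l' =>
            simp only [List.head?_cons, Option.mem_def, Option.some.injEq] at hx
            exact ⟨l', by rw [hx]⟩
        rcases List.mem_cons.mp hmem' with rfl | h'
        · omega
        · have := htail v h'
          omega
      · rw [hf _ h0 (by omega), hf _ (by omega) hlt] at he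
        have := (List.Nodup.getElem_inj_iff hnd).mp he
        omega
    exact (eq_or_eq_of_degree_eq_two hd hprev (hadj t hlt) hne hy).imp id fun h => ⟨hlt, h⟩
  · left
    have : f t = x := by
      rw [hf t h1 h2]
      cases l with
      | nil => exact absurd rfl hlne
      | cons x' l' =>
        simp only [List.head?_cons, Option.mem_def, Option.some.injEq] at hx
        simp [heq, hx]
    rw [this] at hy hprev
    exact eq_of_degree_eq_one hx1 hy hprev

/-- The vertices `f 1, …, f m` of a thread of length `m` without vertices of `S`: they are on no
cycle, and every vertex of `S` is joined to them through the thread. -/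
lemma IsFreeThread.exists_spine (hG : G.Connected) {v : V} {l : List V}
    (h : G.IsFreeThread S v l) :
    ∃ f : ℕ → V, f 0 = v ∧ 1 ≤ l.length ∧
      (∀ t < l.length, G.Adj (f t) (f (t + 1))) ∧
      (∀ t ≤ l.length, ∀ s ∈ S, G.dist s (f t) = G.dist s v + t) ∧
      ∀ t, 1 ≤ t → t ≤ l.length → ∀ (u : V) (p : G.Walk u u), p.IsCycle → f t ∉ p.support := by
  obtain ⟨f, h0, hm, hmem, hadj, hnb⟩ := h.1.exists_spine
  refine ⟨f, h0, hm, hadj, ?_, ?_⟩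
  · intro t ht s hs
    -- From the leaf inwards: the neighbour of `f t` towards `s` cannot be `f (t + 1)`, already
    -- known to be farther from `s` than `f t`.
    have key : ∀ r, r < l.length → G.dist s (f (l.length - r)) =
        G.dist s (f (l.length - r - 1)) + 1 := by
      intro r
      induction r with
      | zero =>
        intro _
        have hne : f l.length ≠ s := by
          rintro rfl
          exact h.2 _ (hmem _ hm le_rfl) hs
        obtain ⟨b, hb, hd⟩ := hG.exists_adj_dist_add_one hne
        rcases hnb _ hm le_rfl b hb with rfl | ⟨h', -⟩
        · rw [dist_comm, dist_comm (u := s)]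
          simpa using hd.symm
        · omega
      | succ r ih =>
        intro hr
        have hne : f (l.length - (r + 1)) ≠ s := by
          rintro rfl
          exact h.2 _ (hmem _ (by omega) (by omega)) hs
        obtain ⟨b, hb, hd⟩ := hG.exists_adj_dist_add_one hne
        rcases hnb _ (by omega) (by omega) b hb with rfl | ⟨-, rfl⟩
        · rw [dist_comm, dist_comm (u := s)]
          exact hd.symm
        · have := ih (by omega)
          rw [show l.length - (r + 1) + 1 = l.length - r by omega] at hd
          rw [show l.length - (r + 1) = l.length - r - 1 by omega] at hd
          rw [dist_comm, dist_comm (v := s)] at hd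
          omega
    induction t with
    | zero => simp [h0]
    | succ t ih =>
      have h1 := key (l.length - (t + 1)) (by omega)
      rw [show l.length - (l.length - (t + 1)) = t + 1 by omega, Nat.add_sub_cancel,
        ih (by omega)] at h1
      omega
  -- Again from the leaf inwards: a cycle vertex has two neighbours on the cycle, but once the outer
  -- neighbour is excluded only one remains.
  · have key : ∀ r, r < l.length → ∀ (u : V) (p : G.Walk u u), p.IsCycle →
        f (l.length - r) ∉ p.support := by
      intro r
      induction r with
      | zero =>
        intro _ u p hp hx
        obtain ⟨y, z, hyz, hy, hz⟩ := hp.exists_two_neighbors hx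
        have h1 := hnb _ hm le_rfl y (p.edges_subset_edgeSet hy)
        have h2 := hnb _ hm le_rfl z (p.edges_subset_edgeSet hz)
        simp only [lt_irrefl, false_and, or_false] at h1 h2
        exact hyz (h1.trans h2.symm)
      | succ r ih =>
        intro hr u p hp hx
        obtain ⟨y, z, hyz, hy, hz⟩ := hp.exists_two_neighbors hx
        have h1 := hnb _ (by omega) (by omega) y (p.edges_subset_edgeSet hy)
        have h2 := hnb _ (by omega) (by omega) z (p.edges_subset_edgeSet hz)
        have e : l.length - (r + 1) + 1 = l.length - r := by omega
        rw [e] at h1 h2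
        have hnot := ih (by omega) u p hp
        rcases h1 with h1 | ⟨-, rfl⟩
        · rcases h2 with h2 | ⟨-, rfl⟩
          · exact hyz (h1.trans h2.symm)
          · exact hnot ((Walk.mem_support_iff_mem_edgeSet hp _).mpr ⟨_, hz, by simp⟩)
        · exact hnot ((Walk.mem_support_iff_mem_edgeSet hp _).mpr ⟨_, hy, by simp⟩)
    intro t h1 h2
    have := key (l.length - t) (by omega)
    rwa [show l.length - (l.length - t) = t by omega] at this

end Degree

end SimpleGraph

namespace SimpleGraph

variable {V : Type*} {G : SimpleGraph V} {S : Set V} {κ : ℕ}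

/-! ### Free edges

The vertex and the edge version of the theorem are treated together: the parameter `κ` is `1` in
the vertex version and `0` in the edge version. -/

/-- No vertex of `S` is closer to the edge `wb` through `b` than through `w`, by at least `κ`. -/
def IsFreeEdge (G : SimpleGraph V) (S : Set V) (κ : ℕ) (w b : V) : Prop :=
  G.Adj w b ∧ ∀ s ∈ S, G.dist s w + κ ≤ G.dist s b

/-- Two free edges start at the same vertex. -/
def HasFreePair (G : SimpleGraph V) (S : Set V) (κ : ℕ) : Prop :=
  ∃ w b c, b ≠ c ∧ G.IsFreeEdge S κ w b ∧ G.IsFreeEdge S κ w c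

/-- The common form of `ConfigB` and `ConfigD`. -/
def ConfigThread (G : SimpleGraph V) [G.LocallyFinite] (S : Set V) (κ : ℕ) {u : V}
    (p : G.Walk u u) : Prop :=
  2 * G.lastActive S p + 1 + κ ≤ p.length ∧
    ∃ i : ℕ, ((G.lastActive S p ≤ i ∧ 2 * i + 1 + κ ≤ p.length) ∨
        (p.length + 2 * G.lastActive S p + 1 + κ ≤ 2 * i ∧ i + 1 ≤ p.length) ∨ i = 0) ∧
      ∃ l, G.IsFreeThread S (p.getVert i) l

lemma configB_iff [G.LocallyFinite] {u : V} (p : G.Walk u u) :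
    G.ConfigB S p ↔ G.ConfigThread S 1 p := by
  refine and_congr (by omega) (exists_congr fun i => and_congr (by omega) Iff.rfl)

lemma configD_iff [G.LocallyFinite] {u : V} (p : G.Walk u u) :
    G.ConfigD S p ↔ G.ConfigThread S 0 p := by
  refine and_congr (by omega) (exists_congr fun i => and_congr (by omega) Iff.rfl)

/-- The common form of `IsVertexCritical` and `IsEdgeCritical`. -/
def IsCritical (G : SimpleGraph V) (S : Set V) (κ : ℕ) {u : V} (p : G.Walk u u) (v : V) : Prop :=
  ∃ (a b : V) (P : G.Walk a b), G.IsSPath S p P ∧ (v = a ∨ v = b) ∧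
    2 * P.length + 1 + κ ≤ p.length

lemma isVertexCritical_iff {u : V} (p : G.Walk u u) (v : V) :
    G.IsVertexCritical S p v ↔ G.IsCritical S 1 p v :=
  exists_congr fun _ => exists_congr fun _ => exists_congr fun _ =>
    and_congr Iff.rfl (and_congr Iff.rfl (by omega))

lemma isEdgeCritical_iff {u : V} (p : G.Walk u u) (v : V) :
    G.IsEdgeCritical S p v ↔ G.IsCritical S 0 p v :=
  exists_congr fun _ => exists_congr fun _ => exists_congr fun _ =>
    and_congr Iff.rfl (and_congr Iff.rfl (by omega))

/-- The common form of `VertexCriticallyIncident` and `EdgeCriticallyIncident`. -/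
def CriticallyIncident (G : SimpleGraph V) (S : Set V) (κ : ℕ) {u w : V} (p : G.Walk u u)
    (q : G.Walk w w) : Prop :=
  p.edgeSet ≠ q.edgeSet ∧ ∃ v, v ∈ p.support ∧ v ∈ q.support ∧
    G.IsCritical S κ p v ∧ G.IsCritical S κ q v

lemma vertexCriticallyIncident_iff {u w : V} (p : G.Walk u u) (q : G.Walk w w) :
    G.VertexCriticallyIncident S p q ↔ G.CriticallyIncident S 1 p q := by
  simp only [VertexCriticallyIncident, CriticallyIncident, isVertexCritical_iff]

lemma edgeCriticallyIncident_iff {u w : V} (p : G.Walk u u) (q : G.Walk w w) :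
    G.EdgeCriticallyIncident S p q ↔ G.CriticallyIncident S 0 p q := by
  simp only [EdgeCriticallyIncident, CriticallyIncident, isEdgeCritical_iff]

/-! ### Free edges on a cycle -/

section Window

variable {w : V} {p : G.Walk w w}

/-- The last edge of a labelled cycle is free iff all active vertices are in the first half. -/
lemma IsCactus.isFreeEdge_last_iff (hG : G.IsCactus) (hκ : κ ≤ 1) (hp : p.IsCycle) :
    G.IsFreeEdge S κ w (p.getVert (p.length - 1)) ↔
      ∀ s ∈ S, 2 * gateIdx p s + 1 + κ ≤ p.length := by
  have h3 := hp.three_le_length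
  have hadj : G.Adj w (p.getVert (p.length - 1)) := by
    have := p.adj_getVert_succ (i := p.length - 1) (by omega)
    rw [show p.length - 1 + 1 = p.length by omega, p.getVert_length] at this
    exact this.symm
  simp only [IsFreeEdge, hadj, true_and]
  refine forall₂_congr fun s _ => ?_
  have h1 := hG.dist_getVert hp s (Nat.zero_le _)
  have h2 := hG.dist_getVert hp s (Nat.sub_le p.length 1)
  have h4 := hG.gateIdx_lt hp s
  rw [p.getVert_zero] at h1
  rw [h1, h2]
  simp only [cycDist]
  omega

/-- The arc `v_0 ⋯ v_k` is shorter than half the cycle, hence a shortest path in `G`; any path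
containing its two active ends is at least as long. -/
lemma IsCactus.isCritical_of_window (hG : G.IsCactus) (hp : p.IsCycle)
    (hw : w ∈ G.activeSet S p) (h : ∀ s ∈ S, 2 * gateIdx p s + 1 + κ ≤ p.length) :
    G.IsCritical S κ p w := by
  have h3 := hp.three_le_length
  obtain ⟨hk, s, hs⟩ := lastActive_spec hp ⟨w, hw⟩
  have hk2 : 2 * G.lastActive S p + 1 + κ ≤ p.length := by
    obtain ⟨s, hs, hs'⟩ := (hG.getVert_mem_activeSet_iff hp hk).mp ⟨s, hs⟩
    rw [← hs']
    exact h s hs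
  set k := G.lastActive S p with hkdef
  have hlen : (p.take k).length = k := by rw [p.take_length]; omega
  have hdist : G.dist w (p.getVert k) = k := by
    have := hG.dist_getVert_getVert hp (i := 0) (by omega) hk.le
    rw [p.getVert_zero] at this
    rw [this]
    simp only [cycDist]; omega
  refine ⟨w, p.getVert k, p.take k, ⟨⟨?_, ?_, ?_, ?_⟩, ?_⟩, Or.inl rfl, by rw [hlen]; exact hk2⟩
  · rw [← Walk.IsPath.getVert_injOn_iff, hlen]
    intro i hi j hj hij
    simp only [Set.mem_ofPred_eq] at hi hj
    rw [p.take_getVert, p.take_getVert, min_eq_right hi, min_eq_right hj] at hij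
    exact hp.getVert_inj (by omega) (by omega) hij
  · intro e he
    obtain ⟨i, hi, rfl⟩ := ((p.take k).mem_edgeSet_iff_getVert e).mp he
    rw [p.take_getVert, p.take_getVert, min_eq_right (by omega), min_eq_right (by omega)]
    exact p.edge_getVert_mem (by omega)
  · intro v hv
    obtain ⟨i, rfl, -⟩ := Walk.mem_support_iff_exists_getVert.mp hv
    rw [p.take_getVert]
    exact p.getVert_mem_support _
  · intro v hv
    obtain ⟨i, hi, rfl⟩ := Walk.exists_getVert_lt hp hv.1
    have := le_lastActive hi hv
    have h' := (p.take k).getVert_mem_support i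
    rwa [p.take_getVert, min_eq_right (by omega)] at h'
  · intro c d Q hQ
    rw [hlen]
    have h1 := hQ.2.2.2 w hw
    have h2 := hQ.2.2.2 _ ⟨s, hs⟩
    have := dist_le_length_of_mem_support h1 h2
    omega

/-- Since `w` need not be active, the cycle is relabelled backwards from the last active vertex
`v_k`. This puts `w` at position `k`, with no active position after it, so the thread falls into the
first range of `ConfigThread`. -/
lemma IsCactus.exists_configThread_of_window [G.LocallyFinite] (hG : G.IsCactus)
    (hbi : G.IsBiactive S) (hp : p.IsCycle)
    (h : ∀ s ∈ S, 2 * gateIdx p s + 1 + κ ≤ p.length) {l : List V}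
    (hl : G.IsFreeThread S w l) :
    ∃ (u : V) (q : G.Walk u u), G.IsCanonicalCycle S q ∧ G.ConfigThread S κ q := by
  have h3 := hp.three_le_length
  obtain ⟨s₀, hs₀, -⟩ := hG.exists_gateIdx_ne hbi hp 0
  obtain ⟨hk, hkact⟩ := lastActive_spec hp ⟨_, hG.getVert_gateIdx_mem_activeSet hp hs₀⟩
  have hk2 : 2 * G.lastActive S p + 1 + κ ≤ p.length := by
    obtain ⟨s, hs, hs'⟩ := (hG.getVert_mem_activeSet_iff hp hk).mp hkact
    rw [← hs']
    exact h s hs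
  set k := G.lastActive S p with hkdef
  obtain ⟨q, hq, hqe, hql, hq1, hq2⟩ := hp.reverse.exists_rotate (j := p.length - k)
    (by rw [Walk.length_reverse]; omega)
  rw [Walk.length_reverse] at hql hq1 hq2
  rw [Walk.edgeSet_reverse] at hqe
  have hact := activeSet_eq_of_edgeSet_eq (S := S) hp hq hqe
  have hstart : p.reverse.getVert (p.length - k) = p.getVert k := by
    rw [p.getVert_reverse]
    congr 1; omega
  have hqk : q.getVert k = w := by
    rw [hq1 k (by omega), show k + (p.length - k) = p.length by omega, p.getVert_reverse]
    simp
  have hlast : G.lastActive S q ≤ k := by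
    refine lastActive_le hq ⟨_, by rw [hact]; exact hkact⟩ fun i hi hi' => ?_
    by_contra hik
    rw [hact, hq2 i (by omega) (by omega), p.getVert_reverse] at hi'
    have := le_lastActive (by omega) hi'
    omega
  refine ⟨_, q, hG.isCanonicalCycle hq ?_ (by omega), by omega, k, Or.inl ⟨hlast, by omega⟩, l, ?_⟩
  · rw [hact, hstart]
    exact hkact
  · rwa [hqk]

end Window

/-- Off a cycle through `w`, all vertices have gate `w` in another cycle through `w`. -/
lemma IsCactus.gateIdx_eq_zero_of_ne_zero (hG : G.IsCactus) {w : V} {p q : G.Walk w w}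
    (hp : p.IsCycle) (hq : q.IsCycle) (hpq : p.edgeSet ≠ q.edgeSet) {z : V}
    (hz : gateIdx p z ≠ 0) : gateIdx q z = 0 := by
  have aux : ∀ (p q : G.Walk w w), p.IsCycle → q.IsCycle → p.edgeSet ≠ q.edgeSet →
      ∀ x ∈ p.support, gateIdx q x = 0 := by
    intro p q hp hq hpq x hx
    obtain ⟨i, hi, rfl⟩ := Walk.exists_getVert_lt hp hx
    have hr : (G.deleteEdges q.edgeSet).Reachable (p.getVert 0) (p.getVert i) :=
      reachable_getVert_of_subset p (Nat.zero_le _) fun t _ ht => by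
        rw [deleteEdges_adj]
        refine ⟨p.adj_getVert_succ (by omega), fun h => hpq ?_⟩
        exact hG.edgeSet_eq hp hq (p.edge_getVert_mem (by omega)) h
    rw [← hG.gateIdx_eq_of_reachable hq hr, p.getVert_zero]
    have h3 := hq.three_le_length
    have := hG.gateIdx_getVert hq (i := 0) (by omega)
    rwa [q.getVert_zero] at this
  rw [← aux p q hp hq hpq _ (p.getVert_mem_support (gateIdx p z))]
  obtain ⟨W⟩ := hG.reachable_gateIdx hp z
  -- All vertices of `q` have gate `w` on `p`, so a walk off `p` in another component never uses an
  -- edge of `q`.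
  have key : ∀ {x y : V} (W : (G.deleteEdges p.edgeSet).Walk x y), gateIdx p x ≠ 0 →
      gateIdx q y = gateIdx q x := by
    intro x y W
    induction W with
    | nil => exact fun _ => rfl
    | cons h W ih =>
      intro hx
      rw [ih (by rwa [← hG.gateIdx_eq_of_reachable hp h.reachable])]
      refine (hG.gateIdx_eq_of_adj hq (deleteEdges_le _ h) fun he => hx ?_).symm
      exact aux q p hq hp hpq.symm _ ((Walk.mem_support_iff_mem_edgeSet hq _).mpr
        ⟨_, he, Sym2.mem_mk_left _ _⟩)
  refine key W ?_
  rwa [hG.gateIdx_getVert hp (hG.gateIdx_lt hp z)]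

/-! ### From free pairs to threads and critical incidence -/

lemma IsFreeEdge.side_free (hG : G.Connected) {w b : V} (h : G.IsFreeEdge S κ w b)
    (hb : G.IsBridge s(w, b)) : ∀ y, (G.deleteEdges {s(w, b)}).Reachable b y → y ∉ S := by
  intro y hy hyS
  have h1 := hG.dist_of_reachable_right h.1 hb hy
  have h2 := h.2 y hyS
  omega

/-- Both far sides are paths without `S`. If `w` has a third neighbour they are two free threads at
`w`; otherwise they and `w` make up the whole graph, which is then a path. -/
lemma IsCactus.not_bridge_bridge [Finite V] [G.LocallyFinite] (hG : G.IsCactus)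
    (hpath : ¬ (G.IsAcyclic ∧ ∀ v, G.degree v ≤ 2)) (hbi : G.IsBiactive S)
    (hbr : G.IsBranchResolving S) {w b b' : V} (hbb' : b ≠ b') (h : G.IsFreeEdge S κ w b)
    (h' : G.IsFreeEdge S κ w b') (hb : G.IsBridge s(w, b)) (hb' : G.IsBridge s(w, b')) :
    False := by
  have hf := h.side_free hG.1 hb
  have hf' := h'.side_free hG.1 hb'
  obtain ⟨l, hl⟩ := hG.exists_isPathSide hbi hbr h.1 hb hf
  obtain ⟨l', hl'⟩ := hG.exists_isPathSide hbi hbr h'.1 hb' hf'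
  by_cases hdeg : 3 ≤ G.degree w
  · have h1 := hl.isFreeThread h.1 hdeg hf
    have h2 := hl'.isFreeThread h'.1 hdeg hf'
    have h3 := hl.last
    rw [hbr w l l' h1 h2] at h3
    exact hbb' (Option.mem_unique h3 hl'.last)
  · have hsides : ∀ y, y ≠ w → (G.deleteEdges {s(w, b)}).Reachable b y ∨
        (G.deleteEdges {s(w, b')}).Reachable b' y := by
      intro y hy
      obtain ⟨c, hc, hd⟩ := hG.1.exists_adj_dist_add_one hy.symm
      have hc' : c = b ∨ c = b' := by
        by_contra! hne
        exact hdeg (three_le_degree h.1 h'.1 hc hbb' hne.1.symm hne.2.symm)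
      rcases hc' with rfl | rfl
      · left
        refine hG.1.reachable_right_of_dist h.1 hb ?_
        rw [dist_comm, dist_comm (v := w)]; omega
      · right
        refine hG.1.reachable_right_of_dist h'.1 hb' ?_
        rw [dist_comm, dist_comm (v := w)]; omega
    refine hpath ⟨fun u p hp => ?_, fun v => ?_⟩
    · obtain ⟨x, hx, hxw⟩ : ∃ x ∈ p.support, x ≠ w := by
        by_contra! hne
        have h3 := hp.three_le_length
        have := hp.getVert_inj (i := 0) (j := 1) (by omega) (by omega)
          ((hne _ (p.getVert_mem_support _)).trans (hne _ (p.getVert_mem_support _)).symm)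
        omega
      rcases hsides x hxw with hr | hr
      · exact hG.not_reachable_of_side_free hbi hb hf hp hx hr
      · exact hG.not_reachable_of_side_free hbi hb' hf' hp hx hr
    · by_cases hv : v = w
      · rw [hv]; omega
      · exact (hsides v hv).elim (hl.degree_le v) (hl'.degree_le v)

lemma IsCactus.exists_configThread_of_bridge [Finite V] [G.LocallyFinite] (hG : G.IsCactus)
    (hbi : G.IsBiactive S) (hbr : G.IsBranchResolving S) (hκ : κ ≤ 1) {w b b' : V}
    (h : G.IsFreeEdge S κ w b) (h' : G.IsFreeEdge S κ w b') (hb : G.IsBridge s(w, b))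
    (hb' : ¬ G.IsBridge s(w, b')) :
    ∃ (u : V) (q : G.Walk u u), G.IsCanonicalCycle S q ∧ G.ConfigThread S κ q := by
  obtain ⟨p, hp, rfl⟩ := exists_cycle_of_not_isBridge' h'.1 hb'
  have h3 := hp.three_le_length
  have hf := h.side_free hG.1 hb
  obtain ⟨l, hl⟩ := hG.exists_isPathSide hbi hbr h.1 hb hf
  obtain ⟨y, z, hyz, hy, hz⟩ := hp.exists_two_neighbors p.start_mem_support
  have hne : ∀ y, s(w, y) ∈ p.edgeSet → b ≠ y := by
    rintro y hy rfl
    exact hp.not_isBridge hy hb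
  have hdeg : 3 ≤ G.degree w := three_le_degree h.1 (p.edges_subset_edgeSet hy)
    (p.edges_subset_edgeSet hz) (hne y hy) (hne z hz) hyz
  exact hG.exists_configThread_of_window hbi hp ((hG.isFreeEdge_last_iff hκ hp).mp h')
    (hl.isFreeThread h.1 hdeg hf)

lemma IsCactus.exists_configThread_or_criticallyIncident [Finite V] [G.LocallyFinite]
    (hG : G.IsCactus) (hpath : ¬ (G.IsAcyclic ∧ ∀ v, G.degree v ≤ 2)) (hbi : G.IsBiactive S)
    (hbr : G.IsBranchResolving S) (hκ : κ ≤ 1) (h : G.HasFreePair S κ) :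
    (∃ (u : V) (q : G.Walk u u), G.IsCanonicalCycle S q ∧ G.ConfigThread S κ q) ∨
      ∃ (u v : V) (p : G.Walk u u) (q : G.Walk v v), p.IsCycle ∧ q.IsCycle ∧
        G.CriticallyIncident S κ p q := by
  obtain ⟨w, b, b', hne, h, h'⟩ := h
  by_cases hb : G.IsBridge s(w, b)
  · by_cases hb' : G.IsBridge s(w, b')
    · exact (hG.not_bridge_bridge hpath hbi hbr hne h h' hb hb').elim
    · exact Or.inl (hG.exists_configThread_of_bridge hbi hbr hκ h h' hb hb')
  by_cases hb' : G.IsBridge s(w, b')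
  · exact Or.inl (hG.exists_configThread_of_bridge hbi hbr hκ h' h hb' hb)
  right
  obtain ⟨p, hp, rfl⟩ := exists_cycle_of_not_isBridge' h.1 hb
  obtain ⟨q, hq, rfl⟩ := exists_cycle_of_not_isBridge' h'.1 hb'
  have h3 := hp.three_le_length
  have h3' := hq.three_le_length
  have hwin := (hG.isFreeEdge_last_iff hκ hp).mp h
  have hwinq := (hG.isFreeEdge_last_iff hκ hq).mp h'
  by_cases hpq : p.edgeSet = q.edgeSet
  -- On one cycle the edges lead to `v_{g-1}` and `v_1`. Freeness of the first puts all active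
  -- positions in the first half, where every position except `0` is closer to `v_1` than to `v_0`.
  · exfalso
    have hq1 : s(w, q.getVert (q.length - 1)) ∈ p.edgeSet := by
      rw [hpq]
      have := q.edge_getVert_mem (i := q.length - 1) (by omega)
      rwa [show q.length - 1 + 1 = q.length by omega, q.getVert_length, Sym2.eq_swap] at this
    have hp1 : q.getVert (q.length - 1) = p.getVert 1 := by
      obtain ⟨j, hj, he⟩ := (p.mem_edgeSet_iff_getVert _).mp hq1
      rcases Sym2.eq_iff.mp he with ⟨h1, h2⟩ | ⟨h1, h2⟩
      · have := hp.getVert_inj (i := 0) (by omega) hj (p.getVert_zero.trans h1)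
        rw [h2, ← this]
      · by_cases hj' : j + 1 < p.length
        · have := hp.getVert_inj (i := 0) (by omega) hj' (p.getVert_zero.trans h1)
          omega
        · exact absurd (by rw [h2]; congr 1; omega) hne
    obtain ⟨s, hs, hs0⟩ := hG.exists_gateIdx_ne hbi hp 0
    have h5 := h'.2 s hs
    have h6 := hG.dist_getVert hp s (Nat.zero_le _)
    rw [p.getVert_zero] at h6
    rw [hp1, hG.dist_getVert hp s (show 1 ≤ p.length by omega), h6] at h5
    have h7 := hwin s hs
    simp only [cycDist] at h5
    omega
  -- By biactivity some vertex of `S` has a gate other than `w` on the other cycle; its gate on this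
  -- cycle is then `w`, so `w` is active.
  · have hact : ∀ (p q : G.Walk w w), p.IsCycle → q.IsCycle → p.edgeSet ≠ q.edgeSet →
        w ∈ G.activeSet S p := by
      intro p q hp hq hpq
      have h3 := hp.three_le_length
      have := hG.getVert_mem_activeSet_iff (S := S) hp (i := 0) (by omega)
      rw [p.getVert_zero] at this
      obtain ⟨s, hs, hs0⟩ := hG.exists_gateIdx_ne hbi hq 0
      exact this.mpr ⟨s, hs, hG.gateIdx_eq_zero_of_ne_zero hq hp (Ne.symm hpq) hs0⟩
    exact ⟨w, w, p, q, hp, hq, hpq, w, p.start_mem_support, q.start_mem_support,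
      hG.isCritical_of_window hp (hact p q hp hq hpq) hwin,
      hG.isCritical_of_window hq (hact q p hq hp (Ne.symm hpq)) hwinq⟩

/-! ### The converse -/

/-- One free edge starts the thread. The other is the cycle edge at `v_i` leading away from the
active arc: to `v_{i+1}`, `v_{i-1}` or `v_{g-1}` in the three ranges of `i`. -/
lemma IsCactus.hasFreePair_of_configThread [G.LocallyFinite] (hG : G.IsCactus) (hκ : κ ≤ 1)
    {u : V} {p : G.Walk u u} (hp : p.IsCycle) (h : G.ConfigThread S κ p) :
    G.HasFreePair S κ := by
  have h3 := hp.three_le_length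
  obtain ⟨hk, i, hi, l, hl⟩ := h
  obtain ⟨f, hf0, hm, hfadj, hfd, hfc⟩ := hl.exists_spine hG.1
  have hf1 : G.IsFreeEdge S κ (p.getVert i) (f 1) := by
    refine ⟨?_, fun s hs => ?_⟩
    · have := hfadj 0 (by omega)
      rwa [hf0, zero_add] at this
    · rw [hfd 1 hm s hs]
      omega
  have hne : ∀ j, p.getVert j ≠ f 1 := fun j h =>
    hfc 1 le_rfl hm u p hp (h ▸ p.getVert_mem_support j)
  have key : ∀ j i', i' ≤ p.length → j ≤ p.length → p.getVert i = p.getVert i' →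
      G.Adj (p.getVert i') (p.getVert j) →
      (∀ t ≤ G.lastActive S p, cycDist p.length t i' + κ ≤ cycDist p.length t j) →
      G.HasFreePair S κ := by
    intro j i' hi' hj hii hadj hd
    refine ⟨_, _, _, hne j, ?_, hf1⟩
    rw [hii]
    refine ⟨hadj, fun s hs => ?_⟩
    rw [hG.dist_getVert hp s hi', hG.dist_getVert hp s hj]
    have := hd _ (hG.gateIdx_le_lastActive hp hs)
    omega
  rcases hi with hi | hi | rfl
  · refine key (i + 1) i (by omega) (by omega) rfl (p.adj_getVert_succ (by omega)) ?_
    intro t ht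
    simp only [cycDist]; omega
  · refine key (i - 1) i (by omega) (by omega) rfl ?_ ?_
    · have := p.adj_getVert_succ (i := i - 1) (by omega)
      rw [show i - 1 + 1 = i by omega] at this
      exact this.symm
    · intro t ht
      simp only [cycDist]; omega
  · refine key (p.length - 1) p.length le_rfl (by omega) (by simp) ?_ ?_
    · have := p.adj_getVert_succ (i := p.length - 1) (by omega)
      rw [show p.length - 1 + 1 = p.length by omega] at this
      exact this.symm
    · intro t ht
      simp only [cycDist]; omega

lemma Walk.IsCycle.length_eq_of_edgeSet_eq {u v : V} {p : G.Walk u u} {q : G.Walk v v}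
    (hp : p.IsCycle) (hq : q.IsCycle) (h : p.edgeSet = q.edgeSet) : p.length = q.length := by
  classical
  rw [← Walk.length_edges, ← Walk.length_edges,
    ← List.toFinset_card_of_nodup hp.isTrail.edges_nodup,
    ← List.toFinset_card_of_nodup hq.isTrail.edges_nodup]
  congr 1
  ext e
  simpa using Set.ext_iff.mp h e

/-- Biactivity makes `P` nontrivial, so the cycle can be relabelled from `v` along `P`. Then `P` is
an initial segment containing all active positions, and the closing edge is free. -/
lemma IsCactus.exists_isFreeEdge_of_isActivePath (hG : G.IsCactus) (hbi : G.IsBiactive S)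
    (hκ : κ ≤ 1) {u v b : V} {p : G.Walk u u} (hp : p.IsCycle) {P : G.Walk v b}
    (hP : G.IsActivePath S p P) (hlen : 2 * P.length + 1 + κ ≤ p.length) :
    ∃ n, s(v, n) ∈ p.edgeSet ∧ G.IsFreeEdge S κ v n := by
  obtain ⟨hpath, hedge, hsupp, hact⟩ := hP
  by_cases h0 : P.length = 0
  · exfalso
    have h1 : G.activeSet S p ⊆ {v} := by
      intro x hx
      obtain ⟨i, rfl, hi⟩ := Walk.mem_support_iff_exists_getVert.mp (hact x hx)
      obtain rfl : i = 0 := by omega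
      simp
    have := (hbi u p hp).trans ((Set.encard_le_encard h1).trans_eq (Set.encard_singleton _))
    exact absurd this (by norm_num)
  have hadj : G.Adj v (P.getVert 1) := by
    have := P.adj_getVert_succ (i := 0) (by omega)
    rwa [P.getVert_zero] at this
  have he : s(v, P.getVert 1) ∈ p.edgeSet := by
    have := P.edge_getVert_mem (i := 0) (by omega)
    rw [P.getVert_zero] at this
    exact hedge this
  obtain ⟨q, hq, hq1⟩ := exists_cycle_of_not_isBridge hadj (hp.not_isBridge he)
  have h3 := hq.three_le_length
  have heq : s(v, P.getVert 1) ∈ q.edgeSet := by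
    have := q.edge_getVert_mem (i := 0) (by omega)
    rwa [q.getVert_zero, zero_add, hq1] at this
  have hqp : q.edgeSet = p.edgeSet := hG.edgeSet_eq hq hp heq he
  have hql : q.length = p.length := hq.length_eq_of_edgeSet_eq hp hqp
  have hPq : ∀ i, i + 1 ≤ P.length →
      P.getVert i = q.getVert i ∧ P.getVert (i + 1) = q.getVert (i + 1) := by
    intro i
    induction i with
    | zero => intro _; simp [hq1]
    | succ i ih =>
      intro hi
      obtain ⟨h1, h2⟩ := ih (by omega)
      refine ⟨h2, ?_⟩
      have h4 : s(q.getVert (i + 1), P.getVert (i + 2)) ∈ q.edgeSet := by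
        rw [hqp, ← h2]
        exact hedge (P.edge_getVert_mem (i := i + 1) (by omega))
      rcases hq.eq_of_edge_mem (by omega) h4 with h5 | h5
      · rw [← h1] at h5
        have := hpath.getVert_injOn (by simp only [Set.mem_ofPred_eq]; omega)
          (by simp only [Set.mem_ofPred_eq]; omega) h5
        omega
      · exact h5
  refine ⟨q.getVert (q.length - 1), ?_, (hG.isFreeEdge_last_iff hκ hq).mpr fun s hs => ?_⟩
  · rw [← hqp]
    have := q.edge_getVert_mem (i := q.length - 1) (by omega)
    rwa [show q.length - 1 + 1 = q.length by omega, q.getVert_length, Sym2.eq_swap] at this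
  · have h1 := hG.getVert_gateIdx_mem_activeSet hq hs
    rw [activeSet_eq_of_edgeSet_eq hp hq hqp] at h1
    obtain ⟨i, hi, hi'⟩ := Walk.mem_support_iff_exists_getVert.mp (hact _ h1)
    have h2 : P.getVert i = q.getVert i := by
      rcases hi'.lt_or_eq with h | h
      · exact (hPq i h).1
      · have := (hPq (i - 1) (by omega)).2
        rwa [show i - 1 + 1 = i by omega] at this
    have := hq.getVert_inj (by omega) (hG.gateIdx_lt hq s) (h2 ▸ hi)
    omega

lemma IsCactus.exists_isFreeEdge_of_isCritical (hG : G.IsCactus) (hbi : G.IsBiactive S)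
    (hκ : κ ≤ 1) {u v : V} {p : G.Walk u u} (hp : p.IsCycle) (h : G.IsCritical S κ p v) :
    ∃ n, s(v, n) ∈ p.edgeSet ∧ G.IsFreeEdge S κ v n := by
  obtain ⟨a, b, P, ⟨hP, -⟩, hv, hlen⟩ := h
  rcases hv with rfl | rfl
  · exact hG.exists_isFreeEdge_of_isActivePath hbi hκ hp hP hlen
  · refine hG.exists_isFreeEdge_of_isActivePath hbi hκ hp (P := P.reverse) ?_ (by simpa using hlen)
    exact ⟨hP.1.reverse, by rw [Walk.edgeSet_reverse]; exact hP.2.1,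
      by simpa using hP.2.2.1, by simpa using hP.2.2.2⟩

lemma IsCactus.hasFreePair_of_criticallyIncident (hG : G.IsCactus) (hbi : G.IsBiactive S)
    (hκ : κ ≤ 1) {u v : V} {p : G.Walk u u} {q : G.Walk v v} (hp : p.IsCycle) (hq : q.IsCycle)
    (h : G.CriticallyIncident S κ p q) : G.HasFreePair S κ := by
  obtain ⟨hne, w, -, -, h1, h2⟩ := h
  obtain ⟨n, hn, hn'⟩ := hG.exists_isFreeEdge_of_isCritical hbi hκ hp h1
  obtain ⟨m, hm, hm'⟩ := hG.exists_isFreeEdge_of_isCritical hbi hκ hq h2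
  refine ⟨w, n, m, ?_, hn', hm'⟩
  rintro rfl
  exact hne (hG.edgeSet_eq hp hq hn hm)

end SimpleGraph

namespace SimpleGraph

variable {V : Type*} {G : SimpleGraph V} {S : Set V} {κ : ℕ}

/-! ### Positions of vertices and edges relative to a cycle

Distances are doubled, so that the edge `v_i v_{i+1}` of a cycle of length `g` gets the position
`2 * i + 1` on a cycle of length `2 * g`. -/

lemma cycDist_cases {n i j : ℕ} (hi : i ≤ n) (hj : j ≤ n) :
    (i ≤ j ∧ 2 * j ≤ 2 * i + n ∧ cycDist n i j + i = j) ∨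
    (i ≤ j ∧ 2 * i + n < 2 * j ∧ cycDist n i j + j = n + i) ∨
    (j < i ∧ 2 * i ≤ 2 * j + n ∧ cycDist n i j + j = i) ∨
    (j < i ∧ 2 * j + n < 2 * i ∧ cycDist n i j + i = n + j) := by
  simp only [cycDist]; omega

lemma cycDist_triangle {n i j k : ℕ} (hi : i ≤ n) (hj : j ≤ n) (hk : k ≤ n) :
    cycDist n i k ≤ cycDist n i j + cycDist n j k := by
  simp only [cycDist]
  rcases le_total i j with h1 | h1 <;> rcases le_total j k with h2 | h2 <;>
    rcases le_total i k with h3 | h3 <;> omega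

lemma cycDist_pos {n i j : ℕ} (hi : i < n) (hj : j < n) (hij : i ≠ j) : 0 < cycDist n i j := by
  simp only [cycDist]; omega

lemma cycDist_comm (n i j : ℕ) : cycDist n i j = cycDist n j i := by
  simp only [cycDist]; omega

lemma cycDist_self (n i : ℕ) : cycDist n i i = 0 := by
  simp [cycDist]

/-- The function `D`, a doubled distance, is that of an object at height `H` above the position `P`
of the cycle `p`. -/
structure Located {u : V} (p : G.Walk u u) (D : V → ℕ) (P H : ℕ) : Prop where
  lt : P < 2 * p.length
  le : ∀ s, D s ≤ 2 * G.dist s (p.getVert (gateIdx p s)) +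
    cycDist (2 * p.length) (2 * gateIdx p s) P + H
  eq : ∀ s, 2 * gateIdx p s ≠ P → D s = 2 * G.dist s (p.getVert (gateIdx p s)) +
    cycDist (2 * p.length) (2 * gateIdx p s) P + H

section Located

variable {u : V} {p : G.Walk u u}

lemma cycDist_two_mul (g i j : ℕ) : cycDist (2 * g) (2 * i) (2 * j) = 2 * cycDist g i j := by
  simp only [cycDist]; omega

lemma IsCactus.located_vertex (hG : G.IsCactus) (hp : p.IsCycle) (x : V) :
    Located p (fun s => 2 * G.dist s x) (2 * gateIdx p x)
      (2 * G.dist (p.getVert (gateIdx p x)) x) := by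
  have hx := hG.gateIdx_lt hp x
  refine ⟨by omega, fun s => ?_, fun s hs => ?_⟩
  · have h1 := hG.dist_getVert hp s hx.le
    have h2 := hG.1.dist_triangle (u := s) (v := p.getVert (gateIdx p x)) (w := x)
    rw [cycDist_two_mul]
    omega
  · have h1 := hG.dist_getVert hp s hx.le
    have h2 := hG.dist_eq_of_gateIdx_ne hp (s := s) (x := x) (by omega)
    rw [cycDist_two_mul]
    omega

lemma edgeDist_mk (s a b : V) : G.edgeDist s s(a, b) = min (G.dist s a) (G.dist s b) := rfl

lemma IsCactus.located_edge_off (hG : G.IsCactus) (hp : p.IsCycle) {a c : V}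
    (hac : gateIdx p a = gateIdx p c) :
    Located p (fun s => 2 * G.edgeDist s s(a, c) + 1) (2 * gateIdx p a)
      (2 * G.edgeDist (p.getVert (gateIdx p a)) s(a, c) + 1) := by
  have hx := hG.gateIdx_lt hp a
  refine ⟨by omega, fun s => ?_, fun s hs => ?_⟩
  · have h1 := hG.dist_getVert hp s hx.le
    have h2 := hG.1.dist_triangle (u := s) (v := p.getVert (gateIdx p a)) (w := a)
    have h3 := hG.1.dist_triangle (u := s) (v := p.getVert (gateIdx p a)) (w := c)
    rw [cycDist_two_mul, edgeDist_mk, edgeDist_mk]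
    omega
  · have h1 := hG.dist_getVert hp s hx.le
    have h2 := hG.dist_eq_of_gateIdx_ne hp (s := s) (x := a) (by omega)
    have h3 := hG.dist_eq_of_gateIdx_ne hp (s := s) (x := c) (by omega)
    rw [← hac] at h3
    rw [cycDist_two_mul, edgeDist_mk, edgeDist_mk]
    omega

lemma IsCactus.located_edge_on (hG : G.IsCactus) (hp : p.IsCycle) {i : ℕ} (hi : i < p.length) :
    Located p (fun s => 2 * G.edgeDist s s(p.getVert i, p.getVert (i + 1)) + 1) (2 * i + 1) 0 := by
  have key : ∀ s, 2 * G.edgeDist s s(p.getVert i, p.getVert (i + 1)) + 1 =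
      2 * G.dist s (p.getVert (gateIdx p s)) +
        cycDist (2 * p.length) (2 * gateIdx p s) (2 * i + 1) + 0 := by
    intro s
    have h1 := hG.dist_getVert hp s hi.le
    have h2 := hG.dist_getVert hp s (show i + 1 ≤ p.length by omega)
    have h3 := hG.gateIdx_lt hp s
    rw [edgeDist_mk, h1, h2]
    simp only [cycDist]
    omega
  exact ⟨by omega, fun s => (key s).le, fun s _ => key s⟩

/-! ### Undistinguished objects over two positions of a cycle -/

/-- The location formula can fail only for vertices hanging at the position itself. If some vertex
of `S` hangs at `P`, comparing it with one that does not forces `H = H' + d(P, P')`. If none does,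
then none hangs at `P'` because `H' ≤ H`, and both formulas are exact on `S`. -/
lemma IsCactus.located_cases (hG : G.IsCactus) (hbi : G.IsBiactive S) (hp : p.IsCycle)
    {D D' : V → ℕ} {P P' H H' : ℕ} (h : Located p D P H) (h' : Located p D' P' H')
    (hS : ∀ s ∈ S, D s = D' s) (hPP : P ≠ P') (hHH : H' ≤ H) :
    (H = H' + cycDist (2 * p.length) P P' ∧
      (∀ s ∈ S, D s = 2 * G.dist s (p.getVert (gateIdx p s)) +
        cycDist (2 * p.length) (2 * gateIdx p s) P + H) ∧
      ∀ s ∈ S, cycDist (2 * p.length) (2 * gateIdx p s) P' =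
        cycDist (2 * p.length) (2 * gateIdx p s) P + cycDist (2 * p.length) P P') ∨
    (H < H' + cycDist (2 * p.length) P P' ∧
      ∀ s ∈ S, 2 * gateIdx p s ≠ P ∧ 2 * gateIdx p s ≠ P' ∧
        cycDist (2 * p.length) (2 * gateIdx p s) P + H =
          cycDist (2 * p.length) (2 * gateIdx p s) P' + H') := by
  have hpos := cycDist_pos h.lt h'.lt hPP
  have htri : ∀ s, cycDist (2 * p.length) (2 * gateIdx p s) P' ≤
      cycDist (2 * p.length) (2 * gateIdx p s) P + cycDist (2 * p.length) P P' := fun s => by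
    have := hG.gateIdx_lt hp s
    exact cycDist_triangle (by omega) h.lt.le h'.lt.le
  have hself : ∀ s, 2 * gateIdx p s = P → cycDist (2 * p.length) (2 * gateIdx p s) P = 0 ∧
      cycDist (2 * p.length) (2 * gateIdx p s) P' = cycDist (2 * p.length) P P' := by
    intro s hs
    rw [hs, cycDist_self]
    exact ⟨rfl, rfl⟩
  by_cases hα : ∃ s ∈ S, 2 * gateIdx p s = P
  · left
    obtain ⟨s₀, hs₀, h₀⟩ := hα
    obtain ⟨s₁, hs₁, h₁⟩ := hG.exists_gateIdx_ne hbi hp (gateIdx p s₀)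
    have e0 := hself s₀ h₀
    have e1 := h'.eq s₀ (by omega)
    have e2 := h.le s₀
    have e3 := hS s₀ hs₀
    have f1 := h.eq s₁ (by omega)
    have f2 := h'.le s₁
    have f3 := hS s₁ hs₁
    have f4 := htri s₁
    have hH : H = H' + cycDist (2 * p.length) P P' := by omega
    refine ⟨hH, fun s hs => ?_, fun s hs => ?_⟩
    · by_cases hsP : 2 * gateIdx p s = P
      · have g1 := h'.eq s (by omega)
        have g2 := hself s hsP
        have g3 := hS s hs
        omega
      · exact h.eq s hsP
    · by_cases hsP : 2 * gateIdx p s = P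
      · have g2 := hself s hsP
        omega
      · have g1 := h.eq s hsP
        have g2 := h'.le s
        have g3 := hS s hs
        have g4 := htri s
        omega
  · push Not at hα
    have hα' : ∀ s ∈ S, 2 * gateIdx p s ≠ P' := by
      intro s hs hs'
      have e1 := h.eq s (hα s hs)
      have e2 := h'.le s
      rw [hs', cycDist_self] at e2
      rw [hs', cycDist_comm] at e1
      have e3 := hS s hs
      omega
    have heq : ∀ s ∈ S, cycDist (2 * p.length) (2 * gateIdx p s) P + H =
        cycDist (2 * p.length) (2 * gateIdx p s) P' + H' := by
      intro s hs
      have e1 := h.eq s (hα s hs)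
      have e2 := h'.eq s (hα' s hs)
      have e3 := hS s hs
      omega
    obtain ⟨s₁, hs₁, -⟩ := hG.exists_gateIdx_ne hbi hp 0
    have e1 := heq s₁ hs₁
    have e2 := htri s₁
    rcases (show H ≤ H' + cycDist (2 * p.length) P P' by omega).lt_or_eq with hlt | hH
    · exact Or.inr ⟨hlt, fun s hs => ⟨hα s hs, hα' s hs, heq s hs⟩⟩
    · refine Or.inl ⟨hH, fun s hs => h.eq s (hα s hs), fun s hs => ?_⟩
      have := heq s hs
      omega

/-- Here `2 * i` is on a shortest route from `2 * t` to `P'`, and `hdir` says that `P'` lies ahead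
of it. For even `P'` the vertex `i + 1` is still on the way and strictly farther from `t`; odd `P'`
may be the midpoint `2 * i + 1`, which gives only the weak inequality for `κ = 0`. -/
lemma cycDist_add_le_succ {g i t P' κ : ℕ} (hκ : κ ≤ 1) (hi : i < g) (ht : t < g)
    (hP' : P' < 2 * g) (heven : κ = 0 ∨ P' % 2 = 0)
    (hdir : (2 * i < P' ∧ P' ≤ 2 * i + g) ∨ P' + g ≤ 2 * i)
    (h : cycDist (2 * g) (2 * t) P' =
      cycDist (2 * g) (2 * t) (2 * i) + cycDist (2 * g) (2 * i) P') :
    cycDist g t i + κ ≤ cycDist g t (i + 1) := by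
  rw [cycDist_two_mul] at h
  have h1 := cycDist_cases (n := 2 * g) (i := 2 * t) (j := P') (by omega) hP'.le
  have h2 := cycDist_cases (n := 2 * g) (i := 2 * i) (j := P') (by omega) hP'.le
  have h3 := cycDist_cases (n := g) (i := t) (j := i) ht.le hi.le
  have h4 := cycDist_cases (n := g) (i := t) (j := i + 1) ht.le hi
  generalize cycDist (2 * g) (2 * t) P' = x1 at *
  generalize cycDist (2 * g) (2 * i) P' = x2 at *
  generalize cycDist g t i = x3 at *
  generalize cycDist g t (i + 1) = x4 at *
  rcases h3 with h3 | h3 | h3 | h3 <;> rcases h2 with h2 | h2 | h2 | h2 <;> omega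

lemma cycDist_add_le_pred {g i t P' κ : ℕ} (hκ : κ ≤ 1) (hi1 : 1 ≤ i) (hi : i ≤ g) (ht : t < g)
    (hP' : P' < 2 * g) (heven : κ = 0 ∨ P' % 2 = 0) (hne : P' ≠ 2 * i) (hne' : P' + 2 * g ≠ 2 * i)
    (hdir : ¬ ((2 * i < P' ∧ P' ≤ 2 * i + g) ∨ P' + g ≤ 2 * i))
    (h : cycDist (2 * g) (2 * t) P' =
      cycDist (2 * g) (2 * t) (2 * i) + cycDist (2 * g) (2 * i) P') :
    cycDist g t i + κ ≤ cycDist g t (i - 1) := by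
  rw [cycDist_two_mul] at h
  have h1 := cycDist_cases (n := 2 * g) (i := 2 * t) (j := P') (by omega) hP'.le
  have h2 := cycDist_cases (n := 2 * g) (i := 2 * i) (j := P') (by omega) hP'.le
  have h3 := cycDist_cases (n := g) (i := t) (j := i) ht.le hi
  have h4 := cycDist_cases (n := g) (i := t) (j := i - 1) ht.le (by omega)
  generalize cycDist (2 * g) (2 * t) P' = x1 at *
  generalize cycDist (2 * g) (2 * i) P' = x2 at *
  generalize cycDist g t i = x3 at *
  generalize cycDist g t (i - 1) = x4 at *
  rcases h3 with h3 | h3 | h3 | h3 <;> rcases h2 with h2 | h2 | h2 | h2 <;> omega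

/-- If all vertices of `S` see the position `P'` through `P = 2 * i`, an edge of the cycle at `v_i` is
free. -/
lemma IsCactus.exists_isFreeEdge_of_cycDist (hG : G.IsCactus) (hκ : κ ≤ 1) (hp : p.IsCycle)
    {i P' : ℕ} (hi : i < p.length) (hP' : P' < 2 * p.length) (hne : 2 * i ≠ P')
    (heven : κ = 1 → Even P')
    (h : ∀ s ∈ S, cycDist (2 * p.length) (2 * gateIdx p s) P' =
      cycDist (2 * p.length) (2 * gateIdx p s) (2 * i) + cycDist (2 * p.length) (2 * i) P') :
    ∃ b, gateIdx p b ≠ i ∧ G.IsFreeEdge S κ (p.getVert i) b := by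
  have h3 := hp.three_le_length
  have heven' : κ = 0 ∨ P' % 2 = 0 := by
    rcases Nat.le_one_iff_eq_zero_or_eq_one.mp hκ with h | h
    · exact Or.inl h
    · exact Or.inr (Nat.even_iff.mp (heven h))
  have key : ∀ i' j, i' ≤ p.length → j ≤ p.length → p.getVert i' = p.getVert i →
      p.getVert j ≠ p.getVert i → G.Adj (p.getVert i') (p.getVert j) →
      (∀ s ∈ S, cycDist p.length (gateIdx p s) i' + κ ≤ cycDist p.length (gateIdx p s) j) →
      ∃ b, gateIdx p b ≠ i ∧ G.IsFreeEdge S κ (p.getVert i) b := by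
    intro i' j hi' hj hii hji hadj hd
    refine ⟨p.getVert j, fun hg => hji ?_, ?_, fun s hs => ?_⟩
    · rw [← hg, hG.getVert_gateIdx hp (p.getVert_mem_support j)]
    · rwa [← hii]
    · rw [← hii, hG.dist_getVert hp s hi', hG.dist_getVert hp s hj]
      have := hd s hs
      omega
  by_cases hdir : (2 * i < P' ∧ P' ≤ 2 * i + p.length) ∨ P' + p.length ≤ 2 * i
  · have hadj := p.adj_getVert_succ hi
    exact key i (i + 1) hi.le hi rfl hadj.ne' hadj fun s hs =>
      cycDist_add_le_succ hκ hi (hG.gateIdx_lt hp s) hP' heven' hdir (h s hs)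
  · obtain ⟨i', hi'1, hi'2, hii, hi'⟩ : ∃ i', 1 ≤ i' ∧ i' ≤ p.length ∧
        p.getVert i' = p.getVert i ∧ ((i = i' ∧ i ≠ 0) ∨ (i = 0 ∧ i' = p.length)) := by
      rcases Nat.eq_zero_or_pos i with h0 | h0
      · exact ⟨p.length, by omega, le_rfl, by simp [h0], Or.inr ⟨h0, rfl⟩⟩
      · exact ⟨i, h0, hi.le, rfl, Or.inl ⟨rfl, by omega⟩⟩
    have hadj := p.adj_getVert_succ (i := i' - 1) (by omega)
    rw [show i' - 1 + 1 = i' by omega] at hadj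
    refine key i' (i' - 1) hi'2 (by omega) hii (hii ▸ hadj.ne) hadj.symm fun s hs => ?_
    have hs' := hG.gateIdx_lt hp s
    refine cycDist_add_le_pred hκ hi'1 hi'2 hs' hP' heven' (by omega) (by omega)
      (by omega) ?_
    rcases hi' with ⟨rfl, -⟩ | ⟨rfl, rfl⟩
    · exact h s hs
    · have h1 := h s hs
      simp only [cycDist] at h1 ⊢
      omega

/-- Solutions of the equation `d(a, P) + H = d(a, P') + H'` on a cycle of length `2 * g`. -/
lemma cycDist_balanced {g k P P' H H' : ℕ} (hk0 : 0 < k) (hkg : k < g) (hP : P < 2 * g)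
    (hP' : P' < 2 * g) (hH : H' ≤ H) (hlt : H < H' + cycDist (2 * g) P P')
    (h0 : cycDist (2 * g) 0 P + H = cycDist (2 * g) 0 P' + H')
    (hk : cycDist (2 * g) (2 * k) P + H = cycDist (2 * g) (2 * k) P' + H') :
    P + P' = g + 2 * k ∧ ((P < 2 * k ∧ 2 * k < P' ∧ 2 * k + H = g + H') ∨
      (P' < 2 * k ∧ 2 * k < P ∧ 2 * (g - k) + H = g + H')) := by
  have a1 : (P ≤ g ∧ cycDist (2 * g) 0 P = P) ∨ (g < P ∧ cycDist (2 * g) 0 P + P = 2 * g) := by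
    simp only [cycDist]; omega
  have a2 : (P' ≤ g ∧ cycDist (2 * g) 0 P' = P') ∨
      (g < P' ∧ cycDist (2 * g) 0 P' + P' = 2 * g) := by
    simp only [cycDist]; omega
  have a3 := cycDist_cases (n := 2 * g) (i := 2 * k) (j := P) (by omega) hP.le
  have a4 := cycDist_cases (n := 2 * g) (i := 2 * k) (j := P') (by omega) hP'.le
  have a5 := cycDist_cases (n := 2 * g) (i := P) (j := P') hP.le hP'.le
  generalize cycDist (2 * g) 0 P = x1 at *
  generalize cycDist (2 * g) 0 P' = x2 at *
  generalize cycDist (2 * g) (2 * k) P = x3 at *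
  generalize cycDist (2 * g) (2 * k) P' = x4 at *
  generalize cycDist (2 * g) P P' = x5 at *
  -- The two solutions lie on different arcs between `P` and `P'`. Subtracting the two equations
  -- yields `P + P'`, adding them yields `H` in terms of `H'`.
  have key : P + P' = g + 2 * k ∧ ((P < 2 * k ∧ 2 * k < P') ∨ (P' < 2 * k ∧ 2 * k < P)) := by
    rcases a1 with a1 | a1 <;> rcases a2 with a2 | a2 <;> rcases a5 with a5 | a5 | a5 | a5 <;>
      rcases a3 with a3 | a3 | a3 | a3 <;> rcases a4 with a4 | a4 | a4 | a4 <;>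
        first
        | (exfalso; omega)
        | (refine ⟨by omega, ?_⟩; first | (left; omega) | (right; omega))
  obtain ⟨hsum, hcase⟩ := key
  clear a5 hlt
  refine ⟨hsum, hcase.imp (fun h => ⟨h.1, h.2, ?_⟩) fun h => ⟨h.1, h.2, ?_⟩⟩ <;>
    rcases a1 with a1 | a1 <;> rcases a2 with a2 | a2 <;> omega

/-- Once `0` is a solution, any other solution `t` satisfies `P + P' = g + 2 * t` and is thereby
determined. -/
lemma cycDist_balanced_unique {g k P P' H H' t : ℕ} (hk0 : 0 < k) (hkg : k < g) (hP : P < 2 * g)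
    (hP' : P' < 2 * g) (hH : H' ≤ H) (hlt : H < H' + cycDist (2 * g) P P')
    (h0 : cycDist (2 * g) 0 P + H = cycDist (2 * g) 0 P' + H')
    (hk : cycDist (2 * g) (2 * k) P + H = cycDist (2 * g) (2 * k) P' + H') (htg : t < g)
    (ht : cycDist (2 * g) (2 * t) P + H = cycDist (2 * g) (2 * t) P' + H') : t = 0 ∨ t = k := by
  by_contra! hne
  obtain ⟨h1, h2⟩ := cycDist_balanced hk0 hkg hP hP' hH hlt h0 hk
  obtain ⟨h3, h4⟩ := cycDist_balanced (by omega) htg hP hP' hH hlt h0 ht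
  omega

/-- The case of exactly two active vertices. -/
lemma IsCactus.exists_canonical_of_balanced (hG : G.IsCactus) (hbi : G.IsBiactive S)
    (hp : p.IsCycle) (hu : u ∈ G.activeSet S p) {P P' H H' : ℕ}
    (hP : P < 2 * p.length) (hP' : P' < 2 * p.length) (hHH : H' ≤ H)
    (hlt : H < H' + cycDist (2 * p.length) P P')
    (h : ∀ s ∈ S, cycDist (2 * p.length) (2 * gateIdx p s) P + H =
          cycDist (2 * p.length) (2 * gateIdx p s) P' + H') :
    ∃ (w : V) (q : G.Walk w w), G.IsCanonicalCycle S q ∧ q.length = p.length ∧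
      (G.activeSet S q).encard = 2 ∧ 2 * G.lastActive S q + H = p.length + H' ∧
      ∀ a, P = 2 * a → ∃ i ≤ G.lastActive S q, q.getVert i = p.getVert a ∧
        ∀ a', P' = 2 * a' →
          q.getVert (q.length / 2 + G.lastActive S q - i) = p.getVert a' := by
  have h3 := hp.three_le_length
  obtain ⟨s₀, hs₀, h₀⟩ := (hG.getVert_mem_activeSet_iff (S := S) hp (i := 0) (by omega)).mp
    (by rwa [p.getVert_zero])
  obtain ⟨s₁, hs₁, h₁⟩ := hG.exists_gateIdx_ne hbi hp 0
  have hkg := hG.gateIdx_lt hp s₁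
  have e0 := h s₀ hs₀
  have e1 := h s₁ hs₁
  rw [h₀, mul_zero] at e0
  obtain ⟨hsum, hcase⟩ := cycDist_balanced (by omega) hkg hP hP' hHH hlt e0 e1
  have huniq : ∀ s ∈ S, gateIdx p s = 0 ∨ gateIdx p s = gateIdx p s₁ := fun s hs =>
    cycDist_balanced_unique (by omega) hkg hP hP' hHH hlt e0 e1 (hG.gateIdx_lt hp s) (h s hs)
  have hk1 : p.getVert (gateIdx p s₁) ∈ G.activeSet S p := hG.getVert_gateIdx_mem_activeSet hp hs₁
  set k := gateIdx p s₁ with hkdef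
  have hactive : G.activeSet S p = {u, p.getVert k} := by
    ext v
    constructor
    · intro hv
      obtain ⟨i, hi, rfl⟩ := Walk.exists_getVert_lt hp hv.1
      obtain ⟨s, hs, rfl⟩ := (hG.getVert_mem_activeSet_iff hp hi).mp hv
      rcases huniq s hs with h | h <;> simp [h]
    · rintro (rfl | rfl)
      · exact hu
      · exact hk1
  have huk : u ≠ p.getVert k := by
    intro he
    have := hp.getVert_inj (i := 0) (by omega) hkg (p.getVert_zero.trans he)
    omega
  have hcard : (G.activeSet S p).encard = 2 := by
    rw [hactive, Set.encard_pair huk]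
  -- The new labelling must have `P` on the arc from its first to its last active vertex. This holds
  -- already if `P < 2 * k`; otherwise the labelling restarts at `v_k` and the arc has length `g -
  -- k`. The position opposite to `P` comes from `P + P' = g + 2 * k`.
  rcases hcase with ⟨hPk, hkP', hδ⟩ | ⟨hP'k, hkP, hδ⟩
  · have hlast : G.lastActive S p = k := by
      apply le_antisymm
      · refine lastActive_le hp ⟨u, hu⟩ fun i hi hi' => ?_
        obtain ⟨s, hs, rfl⟩ := (hG.getVert_mem_activeSet_iff hp hi).mp hi'
        rcases huniq s hs with h | h <;> omega
      · exact le_lastActive hkg hk1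
    refine ⟨u, p, hG.isCanonicalCycle hp hu (by omega), rfl, hcard, by omega, fun a ha => ?_⟩
    refine ⟨a, by omega, rfl, fun a' ha' => ?_⟩
    rw [hlast]
    congr 1; omega
  · obtain ⟨q, hq, hqe, hql, hq1, hq2⟩ := hp.exists_rotate hkg.le
    have hact := activeSet_eq_of_edgeSet_eq (S := S) hp hq hqe
    have hqk : q.getVert (p.length - k) = u := by
      rw [hq1 _ (by omega), show p.length - k + k = p.length by omega, p.getVert_length]
    have hlast : G.lastActive S q = p.length - k := by
      apply le_antisymm
      · refine lastActive_le hq ⟨_, by rw [hact]; exact hk1⟩ fun i hi hi' => ?_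
        rw [hact, hactive] at hi'
        rcases hi' with hi' | hi'
        · exact (hq.getVert_inj hi (by omega) (hi'.trans hqk.symm)).le
        · have := hq.getVert_inj hi (by omega) (hi'.trans q.getVert_zero.symm)
          omega
      · exact le_lastActive (by omega) (by rwa [hqk, hact])
    refine ⟨_, q, hG.isCanonicalCycle hq (by rwa [hact]) (by omega), hql, by rw [hact, hcard],
      by omega, fun a ha => ?_⟩
    refine ⟨a - k, by omega, ?_, fun a' ha' => ?_⟩
    · rw [hq1 _ (by omega)]
      congr 1; omega
    · rw [hlast, hq2 _ (by omega) (by omega)]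
      congr 1; omega

/-! ### Threads at inactive vertices of a cycle -/

/-- A cycle through the edge `v_i b` would, by biactivity, have a vertex of `S` hanging at another
of its vertices, which makes `v_i` active on `p`. So the edge is a bridge, and its far side is a
path without `S`. -/
lemma IsCactus.exists_isFreeThread_of_adj [Finite V] [G.LocallyFinite] (hG : G.IsCactus)
    (hbi : G.IsBiactive S) (hbr : G.IsBranchResolving S) (hp : p.IsCycle) {i : ℕ}
    (hi : i < p.length) (hin : ∀ s ∈ S, gateIdx p s ≠ i) {b : V} (hadj : G.Adj (p.getVert i) b)
    (hb : gateIdx p b = i) :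
    ∃ l, G.IsFreeThread S (p.getVert i) l ∧ G.IsBridge s(p.getVert i, b) ∧
      G.IsPathSide (p.getVert i) b l := by
  have hnot : s(p.getVert i, b) ∉ p.edgeSet := fun he => hadj.ne (by
    rw [← hG.getVert_gateIdx hp ((Walk.mem_support_iff_mem_edgeSet hp b).mpr
      ⟨_, he, Sym2.mem_mk_right _ _⟩), hb])
  have hbridge : G.IsBridge s(p.getVert i, b) := by
    by_contra hnb
    obtain ⟨q, hq, hq1⟩ := exists_cycle_of_not_isBridge hadj hnb
    obtain ⟨p', hp', hpe, hpl, -, -⟩ := hp.exists_rotate hi.le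
    obtain ⟨s, hs, hs0⟩ := hG.exists_gateIdx_ne hbi hq 0
    refine hs0 (hG.gateIdx_eq_zero_of_ne_zero hp' hq (fun h => hnot ?_) fun h => hin s hs ?_)
    · rw [← hpe, h]
      have := q.edge_getVert_mem (i := 0) (by have := hq.three_le_length; omega)
      rwa [q.getVert_zero, zero_add, hq1] at this
    · have := hG.reachable_gateIdx hp' s
      rw [h, p'.getVert_zero, hpe] at this
      exact hG.gateIdx_eq hp hi this
  have hfree : G.IsFreeEdge S 1 (p.getVert i) b := by
    refine ⟨hadj, fun s hs => ?_⟩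
    have := hG.dist_eq_of_gateIdx_ne hp (s := s) (x := b) (by rw [hb]; exact hin s hs)
    rw [hb, dist_eq_one_iff_adj.mpr hadj] at this
    exact this.ge
  have hside := hfree.side_free hG.1 hbridge
  obtain ⟨l, hl⟩ := hG.exists_isPathSide hbi hbr hadj hbridge hside
  obtain ⟨y, z, hyz, hy, hz⟩ := hp.exists_two_neighbors (p.getVert_mem_support i)
  have hne : ∀ y, s(p.getVert i, y) ∈ p.edgeSet → b ≠ y := by
    rintro y hy rfl
    exact hnot hy
  have hdeg : 3 ≤ G.degree (p.getVert i) := three_le_degree hadj (p.edges_subset_edgeSet hy)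
    (p.edges_subset_edgeSet hz) (hne y hy) (hne z hz) hyz
  exact ⟨l, hl.isFreeThread hadj hdeg hside, hbridge, hl⟩

/-- A shortest path from the gate to `x` stays in the component, since leaving it means coming back
through the gate. -/
lemma IsCactus.exists_adj_toward (hG : G.IsCactus) (hp : p.IsCycle) {x : V}
    (hx : x ≠ p.getVert (gateIdx p x)) :
    ∃ b, G.Adj (p.getVert (gateIdx p x)) b ∧ gateIdx p b = gateIdx p x ∧
      G.dist b x + 1 = G.dist (p.getVert (gateIdx p x)) x := by
  obtain ⟨b, hb, hd⟩ := hG.1.exists_adj_dist_add_one hx.symm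
  refine ⟨b, hb, ?_, hd⟩
  by_contra hne
  have := hG.dist_eq_of_gateIdx_ne hp hne
  omega

lemma IsCactus.exists_isFreeThread_of_vertex [Finite V] [G.LocallyFinite] (hG : G.IsCactus)
    (hbi : G.IsBiactive S) (hbr : G.IsBranchResolving S) (hp : p.IsCycle) {x : V}
    (hin : ∀ s ∈ S, gateIdx p s ≠ gateIdx p x) (hx : x ≠ p.getVert (gateIdx p x)) :
    ∃ l, G.IsFreeThread S (p.getVert (gateIdx p x)) l ∧
      G.dist (p.getVert (gateIdx p x)) x ≤ l.length := by
  obtain ⟨b, hadj, hb, hd⟩ := hG.exists_adj_toward hp hx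
  obtain ⟨l, hl, hbr', hl'⟩ :=
    hG.exists_isFreeThread_of_adj hbi hbr hp (hG.gateIdx_lt hp x) hin hadj hb
  refine ⟨l, hl, hl'.dist_le x (hG.1.reachable_right_of_dist hadj hbr' ?_)⟩
  rw [dist_comm, dist_comm (u := x)]
  omega

lemma IsCactus.exists_isFreeThread_of_edge [Finite V] [G.LocallyFinite] (hG : G.IsCactus)
    (hbi : G.IsBiactive S) (hbr : G.IsBranchResolving S) (hp : p.IsCycle) {a c : V}
    (hac : G.Adj a c) (hgate : gateIdx p a = gateIdx p c)
    (hin : ∀ s ∈ S, gateIdx p s ≠ gateIdx p a) :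
    ∃ l, G.IsFreeThread S (p.getVert (gateIdx p a)) l ∧
      G.edgeDist (p.getVert (gateIdx p a)) s(a, c) + 1 ≤ l.length := by
  wlog hle : G.dist (p.getVert (gateIdx p a)) a ≤ G.dist (p.getVert (gateIdx p a)) c
    generalizing a c
  · have := this hac.symm hgate.symm (by rwa [← hgate]) (by rw [← hgate]; omega)
    rwa [← hgate, Sym2.eq_swap] at this
  have hcw : c ≠ p.getVert (gateIdx p c) := by
    rintro h
    rw [← hgate] at h
    rw [← h, dist_self, Nat.le_zero, hG.1.dist_eq_zero_iff] at hle
    exact hac.ne hle.symm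
  obtain ⟨b, hadj, hb, hd⟩ := hG.exists_adj_toward hp hcw
  rw [← hgate] at hcw hadj hb hd
  obtain ⟨l, hl, hbr', hl'⟩ :=
    hG.exists_isFreeThread_of_adj hbi hbr hp (hG.gateIdx_lt hp a) hin hadj hb
  refine ⟨l, hl, ?_⟩
  have hc : (G.deleteEdges {s(p.getVert (gateIdx p a), b)}).Reachable b c := by
    refine hG.1.reachable_right_of_dist hadj hbr' ?_
    rw [dist_comm, dist_comm (u := c)]
    omega
  have hcl := hl'.dist_le c hc
  rw [edgeDist_mk, min_eq_left hle]
  rcases hle.lt_or_eq with hlt | heq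
  · omega
  -- Distinct vertices of the path side have distinct distances from its root, so the two ends are
  -- not equally far.
  · exfalso
    have haw : a ≠ p.getVert (gateIdx p a) := by
      intro h
      rw [← h, dist_self, eq_comm, hG.1.dist_eq_zero_iff] at heq
      exact hac.ne heq
    have ha : (G.deleteEdges {s(p.getVert (gateIdx p a), b)}).Reachable b a := by
      refine hc.trans (Adj.reachable ?_)
      rw [deleteEdges_adj]
      refine ⟨hac.symm, fun h => ?_⟩
      rcases Sym2.eq_iff.mp h with ⟨h1, -⟩ | ⟨-, h1⟩
      · exact hcw h1
      · exact haw h1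
    exact hac.ne (hl'.dist_inj a c ha hc heq)

/-! ### Free edges towards vertices and edges off a cycle -/

lemma IsCactus.exists_isFreeEdge_of_vertex (hG : G.IsCactus) (hp : p.IsCycle) {x : V}
    (hx : x ≠ p.getVert (gateIdx p x))
    (h : ∀ s ∈ S, G.dist s x = G.dist s (p.getVert (gateIdx p x)) +
      G.dist (p.getVert (gateIdx p x)) x) :
    ∃ b, gateIdx p b = gateIdx p x ∧ G.IsFreeEdge S 1 (p.getVert (gateIdx p x)) b := by
  obtain ⟨b, hadj, hb, hd⟩ := hG.exists_adj_toward hp hx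
  refine ⟨b, hb, hadj, fun s hs => ?_⟩
  have h1 := h s hs
  have h2 := hG.1.dist_triangle (u := s) (v := b) (w := x)
  omega

lemma IsCactus.exists_isFreeEdge_of_edge (hG : G.IsCactus) (hp : p.IsCycle) {a c : V}
    (hac : G.Adj a c) (hgate : gateIdx p a = gateIdx p c)
    (h : ∀ s ∈ S, G.edgeDist s s(a, c) = G.dist s (p.getVert (gateIdx p a)) +
      G.edgeDist (p.getVert (gateIdx p a)) s(a, c)) :
    ∃ b, gateIdx p b = gateIdx p a ∧ G.IsFreeEdge S 0 (p.getVert (gateIdx p a)) b := by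
  wlog hle : G.dist (p.getVert (gateIdx p a)) a ≤ G.dist (p.getVert (gateIdx p a)) c
    generalizing a c
  · have := this hac.symm hgate.symm (by rwa [← hgate, Sym2.eq_swap]) (by rw [← hgate]; omega)
    rwa [← hgate] at this
  simp only [edgeDist_mk] at h
  by_cases haw : a = p.getVert (gateIdx p a)
  · refine ⟨c, hgate.symm, haw ▸ hac, fun s hs => ?_⟩
    have h1 := h s hs
    omega
  · obtain ⟨b, hb, hf⟩ := hG.exists_isFreeEdge_of_vertex (S := S) hp haw fun s hs => by
      have h1 := h s hs
      have h2 := hG.1.dist_triangle (u := s) (v := p.getVert (gateIdx p a)) (w := a)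
      omega
    exact ⟨b, hb, hf.1, fun s hs => by have := hf.2 s hs; omega⟩

end Located

end SimpleGraph

namespace SimpleGraph

variable {V : Type*} {G : SimpleGraph V} {S : Set V} {κ : ℕ}

/-! ### Pairs that are not separated by a cycle -/

lemma IsFreeEdge.mono {κ' : ℕ} {w b : V} (h : G.IsFreeEdge S κ w b) (hκ : κ' ≤ κ) :
    G.IsFreeEdge S κ' w b :=
  ⟨h.1, fun s hs => (Nat.add_le_add_left hκ _).trans (h.2 s hs)⟩

lemma HasFreePair.mono {κ' : ℕ} (h : G.HasFreePair S κ) (hκ : κ' ≤ κ) : G.HasFreePair S κ' := by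
  obtain ⟨w, b, b', hne, h1, h2⟩ := h
  exact ⟨w, b, b', hne, h1.mono hκ, h2.mono hκ⟩

/-- For empty `S` every edge is free, and biactivity excludes cycles; as `G` is not a path, some
vertex has degree at least 3. -/
lemma IsCactus.hasFreePair_of_eq_empty [G.LocallyFinite] (hG : G.IsCactus)
    (hpath : ¬ (G.IsAcyclic ∧ ∀ v, G.degree v ≤ 2)) (hbi : G.IsBiactive S) (hS : S = ∅) :
    G.HasFreePair S κ := by
  have hacyc : G.IsAcyclic := fun u p hp => by
    obtain ⟨s, hs, -⟩ := hG.exists_gateIdx_ne hbi hp 0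
    simp [hS] at hs
  obtain ⟨v, hv⟩ : ∃ v, 2 < G.degree v := by
    by_contra! h
    exact hpath ⟨hacyc, h⟩
  obtain ⟨b, b', hb, hb', hne⟩ := Finset.one_lt_card_iff.mp
    (show 1 < (G.neighborFinset v).card by rw [card_neighborFinset_eq_degree]; omega)
  rw [mem_neighborFinset] at hb hb'
  exact ⟨v, b, b', hne, ⟨hb, by simp [hS]⟩, ⟨hb', by simp [hS]⟩⟩

/-- A shortest path from `x` to `x'` consists of bridges. Its length is even, since a middle bridge
would leave each vertex of `S` strictly closer to one end; at the midpoint both path edges are free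
for the same reason. -/
lemma IsCactus.hasFreePair_of_vertices (hG : G.IsCactus) (hne : S.Nonempty) {x x' : V}
    (hxx : x ≠ x') (hS : ∀ s ∈ S, G.dist s x = G.dist s x')
    (hsep : ∀ (u : V) (p : G.Walk u u), p.IsCycle → gateIdx p x = gateIdx p x') :
    G.HasFreePair S 1 := by
  obtain ⟨W, hW⟩ := hG.1.exists_walk_length_eq_dist x x'
  set L := W.length with hL
  have hpos : 0 < G.dist x x' := hG.1.pos_dist_of_ne hxx
  have hd : ∀ i ≤ L, G.dist (W.getVert i) x = i ∧ G.dist (W.getVert i) x' = L - i := by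
    intro i hi
    have h1 := dist_getVert_le W i 0
    have h2 := dist_getVert_le W i L
    have h3 := hG.1.dist_triangle (u := x) (v := W.getVert i) (w := x')
    rw [W.getVert_zero] at h1
    rw [hL, W.getVert_length] at h2
    rw [dist_comm (u := x) (v := W.getVert i)] at h3
    omega
  have hbridge : ∀ i < L, G.IsBridge s(W.getVert i, W.getVert (i + 1)) := by
    intro i hi
    by_contra hnb
    obtain ⟨p, hp, hp1⟩ := exists_cycle_of_not_isBridge (W.adj_getVert_succ hi) hnb
    have h3 := hp.three_le_length
    -- At least one end of a cycle edge of `W` is not the common gate of `x` and `x'`. From it both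
    -- halves of `W` would run through that gate, so `W` would not be shortest.
    have key : ∀ j ≤ L, gateIdx p (W.getVert j) ≠ gateIdx p x →
        W.getVert j ∈ p.support → False := by
      intro j hj hne hsupp
      have h1 := hG.dist_eq_of_gateIdx_ne hp hne
      have h2 := hG.dist_eq_of_gateIdx_ne hp (s := W.getVert j) (x := x')
        (by rwa [← hsep _ p hp])
      rw [← hsep _ p hp] at h2
      have h4 := hG.1.dist_triangle (u := x) (v := p.getVert (gateIdx p x)) (w := x')
      rw [dist_comm (u := x) (v := p.getVert (gateIdx p x))] at h4
      have h5 := hd j hj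
      have h6 : 0 < G.dist (W.getVert j) (p.getVert (gateIdx p x)) := by
        refine hG.1.pos_dist_of_ne fun h => hne ?_
        rw [h, hG.gateIdx_getVert hp (hG.gateIdx_lt hp x)]
      omega
    have g0 : gateIdx p (W.getVert i) = 0 := by
      have := hG.gateIdx_getVert hp (i := 0) (by omega)
      rwa [p.getVert_zero] at this
    have g1 : gateIdx p (W.getVert (i + 1)) = 1 := by
      rw [← hp1, hG.gateIdx_getVert hp (by omega)]
    by_cases h : gateIdx p x = 0
    · exact key (i + 1) hi (by omega) (hp1 ▸ p.getVert_mem_support 1)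
    · exact key i hi.le (by omega) p.start_mem_support
  rcases Nat.even_or_odd' L with ⟨m, hm | hm⟩
  · have hm1 : 1 ≤ m := by omega
    have hadj1 := W.adj_getVert_succ (i := m - 1) (by omega)
    have hbr1 := hbridge (m - 1) (by omega)
    rw [show m - 1 + 1 = m by omega] at hadj1 hbr1
    have hadj2 := W.adj_getVert_succ (i := m) (by omega)
    have hbr2 := hbridge m (by omega)
    have d0 := hd (m - 1) (by omega)
    have d1 := hd m (by omega)
    have d2 := hd (m + 1) (by omega)
    refine ⟨W.getVert m, W.getVert (m - 1), W.getVert (m + 1), fun h => ?_,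
      ⟨hadj1.symm, fun s hs => ?_⟩, ⟨hadj2, fun s hs => ?_⟩⟩
    · rw [h] at d0
      omega
    · rcases hG.1.dist_bridge_cases hadj1 hbr1 s with h | h
      · have h1 := hG.1.dist_across_bridge hadj1 hbr1 (s := s) (x := x') (by omega)
          (by rw [dist_comm, dist_comm (u := x')]; omega)
        have h2 := hG.1.dist_triangle (u := s) (v := W.getVert (m - 1)) (w := x)
        have h3 := hS s hs
        omega
      · omega
    · rcases hG.1.dist_bridge_cases hadj2 hbr2 s with h | h
      · omega
      · have h1 := hG.1.dist_across_bridge hadj2.symm (by rwa [Sym2.eq_swap]) (s := s) (x := x)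
          (by omega) (by rw [dist_comm, dist_comm (u := x)]; omega)
        have h2 := hG.1.dist_triangle (u := s) (v := W.getVert (m + 1)) (w := x')
        have h3 := hS s hs
        omega
  · exfalso
    obtain ⟨s, hs⟩ := hne
    have hadj := W.adj_getVert_succ (i := m) (by omega)
    have hbr := hbridge m (by omega)
    have d1 := hd m (by omega)
    have d2 := hd (m + 1) (by omega)
    have h3 := hS s hs
    rcases hG.1.dist_bridge_cases hadj hbr s with h | h
    · have h1 := hG.1.dist_across_bridge hadj hbr (s := s) (x := x') (by omega)
        (by rw [dist_comm, dist_comm (u := x')]; omega)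
      have h2 := hG.1.dist_triangle (u := s) (v := W.getVert m) (w := x)
      omega
    · have h1 := hG.1.dist_across_bridge hadj.symm (by rwa [Sym2.eq_swap]) (s := s) (x := x)
        (by omega) (by rw [dist_comm, dist_comm (u := x)]; omega)
      have h2 := hG.1.dist_triangle (u := s) (v := W.getVert (m + 1)) (w := x')
      omega

/-- The ends of an edge are on the same side of every other bridge. -/
lemma Connected.same_side (hG : G.Connected) {a b c d : V} (hab : G.Adj a b)
    (hb : G.IsBridge s(a, b)) (hcd : G.Adj c d) (hne : s(c, d) ≠ s(a, b)) :
    (G.dist c b = G.dist c a + 1 ∧ G.dist d b = G.dist d a + 1) ∨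
      (G.dist c a = G.dist c b + 1 ∧ G.dist d a = G.dist d b + 1) := by
  have hr : (G.deleteEdges {s(a, b)}).Reachable c d := by
    refine Adj.reachable ?_
    rw [deleteEdges_adj]
    exact ⟨hcd, hne⟩
  exact (hG.reachable_or_reachable a b c).imp
    (fun h => ⟨hG.dist_of_reachable_left hab hb h, hG.dist_of_reachable_left hab hb (h.trans hr)⟩)
    fun h => ⟨hG.dist_of_reachable_right hab hb h, hG.dist_of_reachable_right hab hb (h.trans hr)⟩

/-- With `a` and `c` named as the outer ends, no vertex of `S` lies beyond either edge, as it would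
be closer to that edge. Hence `a` and `c` are equidistant from `S`, and the vertex case applies. -/
lemma IsCactus.hasFreePair_of_edges (hG : G.IsCactus) (hne : S.Nonempty) {a b c d : V}
    (hab : G.Adj a b) (hcd : G.Adj c d) (hbab : G.IsBridge s(a, b)) (hbcd : G.IsBridge s(c, d))
    (hef : s(a, b) ≠ s(c, d)) (hS : ∀ s ∈ S, G.edgeDist s s(a, b) = G.edgeDist s s(c, d))
    (hsep : ∀ (u : V) (p : G.Walk u u), p.IsCycle → gateIdx p a = gateIdx p c) :
    G.HasFreePair S 0 := by
  wlog h1 : G.dist c a = G.dist c b + 1 ∧ G.dist d a = G.dist d b + 1 generalizing a b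
  · refine this hab.symm (by rwa [Sym2.eq_swap]) (by rwa [Sym2.eq_swap])
      (by rwa [Sym2.eq_swap (a := b)]) (fun u p hp => ?_)
      ((hG.1.same_side hab hbab hcd hef.symm).resolve_right h1)
    rw [← hsep u p hp]
    exact hG.gateIdx_eq_of_adj hp hab.symm fun he =>
      hp.not_isBridge he (by rwa [Sym2.eq_swap])
  wlog h2 : G.dist a c = G.dist a d + 1 ∧ G.dist b c = G.dist b d + 1 generalizing c d
  · refine this hcd.symm (by rwa [Sym2.eq_swap]) (by rwa [Sym2.eq_swap (a := d)])
      (by rwa [Sym2.eq_swap (a := d)]) (fun u p hp => ?_) h1.symm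
      ((hG.1.same_side hcd hbcd hab hef).resolve_right h2)
    rw [hsep u p hp]
    exact hG.gateIdx_eq_of_adj hp hcd fun he => hp.not_isBridge he hbcd
  have hac : a ≠ c := by
    rintro rfl
    rw [dist_self] at h2
    omega
  refine (hG.hasFreePair_of_vertices hne hac (fun s hs => ?_) hsep).mono (Nat.zero_le _)
  have h3 := hS s hs
  rw [edgeDist_mk, edgeDist_mk] at h3
  rcases hG.1.dist_bridge_cases hab hbab s with h4 | h4
  · have h5 := hG.1.dist_across_bridge hab hbab (s := s) (x := c) (by omega) (by omega)
    have h6 := hG.1.dist_across_bridge hab hbab (s := s) (x := d) (by omega) (by omega)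
    omega
  · rcases hG.1.dist_bridge_cases hcd hbcd s with h5 | h5
    · have h6 := hG.1.dist_across_bridge hcd hbcd (s := s) (x := a) (by omega) (by omega)
      have h7 := hG.1.dist_across_bridge hcd hbcd (s := s) (x := b) (by omega) (by omega)
      omega
    · omega

/-! ### Undistinguished pairs give configurations -/

lemma IsCactus.exists_active_start (hG : G.IsCactus) (hbi : G.IsBiactive S) {u : V}
    {p : G.Walk u u} (hp : p.IsCycle) :
    ∃ (w : V) (q : G.Walk w w), q.IsCycle ∧ q.edgeSet = p.edgeSet ∧ w ∈ G.activeSet S q := by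
  obtain ⟨s, hs, -⟩ := hG.exists_gateIdx_ne hbi hp 0
  obtain ⟨q, hq, hqe, -⟩ := hp.exists_rotate (hG.gateIdx_lt hp s).le
  refine ⟨_, q, hq, hqe, ?_⟩
  rw [activeSet_eq_of_edgeSet_eq hp hq hqe]
  exact hG.getVert_gateIdx_mem_activeSet hp hs

lemma IsCactus.gateIdx_eq_iff (hG : G.IsCactus) {u : V} {p : G.Walk u u} (hp : p.IsCycle)
    (x y : V) : gateIdx p x = gateIdx p y ↔ (G.deleteEdges p.edgeSet).Reachable x y := by
  refine ⟨fun h => ?_, hG.gateIdx_eq_of_reachable hp⟩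
  have := hG.reachable_gateIdx hp x
  rw [h] at this
  exact this.symm.trans (hG.reachable_gateIdx hp y)

lemma IsCactus.exists_located_edge (hG : G.IsCactus) {u : V} {p : G.Walk u u} (hp : p.IsCycle)
    {e : Sym2 V} (he : e ∈ G.edgeSet) :
    ∃ P H, Located p (fun s => 2 * G.edgeDist s e + 1) P H ∧
      ((∃ i < p.length, e = s(p.getVert i, p.getVert (i + 1)) ∧ P = 2 * i + 1 ∧ H = 0) ∨
        ∃ a c, e = s(a, c) ∧ G.Adj a c ∧ e ∉ p.edgeSet ∧ gateIdx p a = gateIdx p c ∧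
          P = 2 * gateIdx p a ∧ H = 2 * G.edgeDist (p.getVert (gateIdx p a)) e + 1) := by
  by_cases hep : e ∈ p.edgeSet
  · obtain ⟨i, hi, rfl⟩ := (p.mem_edgeSet_iff_getVert e).mp hep
    exact ⟨_, _, hG.located_edge_on hp hi, Or.inl ⟨i, hi, rfl, rfl, rfl⟩⟩
  · induction e with | h a c =>
    have hac : G.Adj a c := he
    have hg := hG.gateIdx_eq_of_adj hp hac hep
    exact ⟨_, _, hG.located_edge_off hp hg, Or.inr ⟨a, c, rfl, hac, hep, hg, rfl, rfl⟩⟩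

section Undistinguished

variable [Finite V] [G.LocallyFinite]

lemma IsCactus.exists_config_of_vertices (hG : G.IsCactus)
    (hpath : ¬ (G.IsAcyclic ∧ ∀ v, G.degree v ≤ 2)) (hbi : G.IsBiactive S)
    (hbr : G.IsBranchResolving S) {x x' : V} (hxx : x ≠ x')
    (hS : ∀ s ∈ S, G.dist s x = G.dist s x') :
    G.HasFreePair S 1 ∨
      ∃ (u : V) (p : G.Walk u u), G.IsCanonicalCycle S p ∧ (G.ConfigA S p ∨ G.ConfigC S p) := by
  rcases S.eq_empty_or_nonempty with hem | hne
  · exact Or.inl (hG.hasFreePair_of_eq_empty hpath hbi hem)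
  by_cases hsep : ∀ (u : V) (p : G.Walk u u), p.IsCycle → gateIdx p x = gateIdx p x'
  · exact Or.inl (hG.hasFreePair_of_vertices hne hxx hS hsep)
  push Not at hsep
  obtain ⟨u₀, p₀, hp₀, hne₀⟩ := hsep
  obtain ⟨u, p, hp, hpe, hu⟩ := hG.exists_active_start hbi hp₀
  have hgne : gateIdx p x ≠ gateIdx p x' := by
    rwa [Ne, hG.gateIdx_eq_iff hp, hpe, ← hG.gateIdx_eq_iff hp₀]
  clear hpe hne₀
  wlog hHH : 2 * G.dist (p.getVert (gateIdx p x')) x' ≤ 2 * G.dist (p.getVert (gateIdx p x)) x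
    generalizing x x'
  · exact this hxx.symm (fun s hs => (hS s hs).symm) hgne.symm (by omega)
  have hx := hG.gateIdx_lt hp x
  have hx' := hG.gateIdx_lt hp x'
  rcases hG.located_cases hbi hp (hG.located_vertex hp x) (hG.located_vertex hp x')
    (fun s hs => by rw [hS s hs]) (by omega) hHH with ⟨hH, hD, hcd⟩ | ⟨hlt, hbal⟩
  · left
    have hpos := cycDist_pos (n := 2 * p.length) (i := 2 * gateIdx p x) (j := 2 * gateIdx p x')
      (by omega) (by omega) (by omega)
    obtain ⟨b', hb', hf'⟩ := hG.exists_isFreeEdge_of_cycDist (κ := 1) le_rfl hp hx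
      (by omega) (by omega) (fun _ => even_two_mul _) hcd
    obtain ⟨b, hb, hf⟩ := hG.exists_isFreeEdge_of_vertex (S := S) hp (x := x) (fun h => by
      rw [← h, dist_self] at hH
      omega) (fun s hs => by
      have h1 := hD s hs
      have h2 := hG.dist_getVert hp s hx.le
      rw [cycDist_two_mul] at h1
      omega)
    exact ⟨_, b, b', fun h => hb' (h ▸ hb), hf, hf'⟩
  · right
    obtain ⟨w, q, hq, hql, hcard, hk, hpos⟩ := hG.exists_canonical_of_balanced hbi hp hu
      (by omega) (by omega) hHH hlt (fun s hs => (hbal s hs).2.2)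
    refine ⟨w, q, hq, ?_⟩
    -- In `2k + H = g + H'` both heights are even, so `g` is even. Equal heights give `k = g/2`;
    -- otherwise `x` is at least `g/2 - k` above its gate, which bounds the thread length.
    rcases hHH.lt_or_eq with hH | hH
    · right
      obtain ⟨i, hi, hqi, -⟩ := hpos _ rfl
      obtain ⟨l, hl, hlen⟩ := hG.exists_isFreeThread_of_vertex hbi hbr hp (x := x)
        (fun s hs h => (hbal s hs).1 (by rw [h])) (fun h => by
          rw [← h, dist_self] at hH
          omega)
      exact ⟨hcard, Nat.even_iff.mpr (by omega), by omega, i, hi, l, hqi ▸ hl, by omega⟩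
    · exact Or.inl ⟨hcard, Nat.even_iff.mpr (by omega), by omega⟩

lemma IsCactus.exists_config_of_edges (hG : G.IsCactus)
    (hpath : ¬ (G.IsAcyclic ∧ ∀ v, G.degree v ≤ 2)) (hbi : G.IsBiactive S)
    (hbr : G.IsBranchResolving S) {e f : Sym2 V} (he : e ∈ G.edgeSet) (hf : f ∈ G.edgeSet)
    (hef : e ≠ f) (hS : ∀ s ∈ S, G.edgeDist s e = G.edgeDist s f) :
    G.HasFreePair S 0 ∨
      ∃ (u : V) (p : G.Walk u u), G.IsCanonicalCycle S p ∧ (G.ConfigA S p ∨ G.ConfigE S p) := by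
  rcases S.eq_empty_or_nonempty with hem | hne
  · exact Or.inl (hG.hasFreePair_of_eq_empty hpath hbi hem)
  by_cases hsep : ∀ (u : V) (p : G.Walk u u), p.IsCycle → e ∉ p.edgeSet ∧ f ∉ p.edgeSet ∧
      ∀ a ∈ e, ∀ c ∈ f, gateIdx p a = gateIdx p c
  · left
    have hbe : G.IsBridge e :=
      (isBridge_iff_forall_cycle_notMem he).mpr fun u p hp => (hsep u p hp).1
    have hbf : G.IsBridge f :=
      (isBridge_iff_forall_cycle_notMem hf).mpr fun u p hp => (hsep u p hp).2.1
    induction e with | h a b =>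
    induction f with | h c d =>
    exact hG.hasFreePair_of_edges hne he hf hbe hbf hef hS fun u p hp =>
      (hsep u p hp).2.2 a (by simp) c (by simp)
  push Not at hsep
  obtain ⟨u₀, p₀, hp₀, hne₀⟩ := hsep
  obtain ⟨u, p, hp, hpe, hu⟩ := hG.exists_active_start hbi hp₀
  obtain ⟨P, H, hloc, hPH⟩ := hG.exists_located_edge hp he
  obtain ⟨P', H', hloc', hPH'⟩ := hG.exists_located_edge hp hf
  have hPP : P ≠ P' := by
    rcases hPH with ⟨i, hi, hei, hP, -⟩ | ⟨a, c, heq, hac, hep, hg, hP, -⟩ <;>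
      rcases hPH' with ⟨j, hj, hfj, hP', -⟩ | ⟨a', c', heq', hac', hfp, hg', hP', -⟩
    · intro h
      obtain rfl : i = j := by omega
      exact hef (hei.trans hfj.symm)
    · omega
    · omega
    · obtain ⟨y, hy, z, hz, hyz⟩ := hne₀ (hpe ▸ hep) (hpe ▸ hfp)
      rw [Ne, hG.gateIdx_eq_iff hp₀, ← hpe, ← hG.gateIdx_eq_iff hp] at hyz
      rw [heq, Sym2.mem_iff] at hy
      rw [heq', Sym2.mem_iff] at hz
      intro h
      apply hyz
      rcases hy with rfl | rfl <;> rcases hz with rfl | rfl <;> omega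
  clear hpe hne₀
  wlog hHH : H' ≤ H generalizing e f P H P' H'
  · exact this hf he hef.symm (fun s hs => (hS s hs).symm) P' H' hloc' hPH' P H hloc hPH hPP.symm
      (by omega)
  rcases hG.located_cases hbi hp hloc hloc' (fun s hs => by rw [hS s hs]) hPP hHH with
    ⟨hH, hD, hcd⟩ | ⟨hlt, hbal⟩
  · left
    have hpos := cycDist_pos hloc.lt hloc'.lt hPP
    rcases hPH with ⟨i, hi, hei, hP, hH0⟩ | ⟨a, c, heq, hac, hep, hg, hP, hH1⟩
    · omega
    have ha := hG.gateIdx_lt hp a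
    subst hP
    obtain ⟨b', hb', hf'⟩ := hG.exists_isFreeEdge_of_cycDist (κ := 0) (Nat.zero_le _) hp ha
      hloc'.lt hPP (by simp) hcd
    obtain ⟨b, hb, hf⟩ := hG.exists_isFreeEdge_of_edge (S := S) hp hac hg (fun s hs => by
      have h1 := hD s hs
      have h2 := hG.dist_getVert hp s ha.le
      rw [cycDist_two_mul] at h1
      rw [← heq]
      omega)
    exact ⟨_, b, b', fun h => hb' (h ▸ hb), hf, hf'⟩
  · right
    obtain ⟨w, q, hq, hql, hcard, hk, hpos⟩ := hG.exists_canonical_of_balanced hbi hp hu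
      hloc.lt hloc'.lt hHH hlt (fun s hs => (hbal s hs).2.2)
    refine ⟨w, q, hq, ?_⟩
    rcases hHH.lt_or_eq with hH | hH
    · right
      rcases hPH with ⟨i, hi, hei, hP, hH0⟩ | ⟨a, c, heq, hac, hep, hg, hP, hH1⟩
      · omega
      obtain ⟨i, hi, hqi, hpos'⟩ := hpos _ hP
      obtain ⟨l, hl, hlen⟩ := hG.exists_isFreeThread_of_edge hbi hbr hp hac hg
        (fun s hs h => (hbal s hs).1 (by rw [h, hP]))
      rw [← heq] at hlen
      -- An edge off the cycle has odd height, an edge on it height `0`. So `g` is odd if `f` is on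
      -- the cycle, and otherwise `g` is even and `f` supplies the second thread.
      rcases hPH' with ⟨j, hj, hfj, hP', hH0'⟩ | ⟨a', c', heq', hac', hfp, hg', hP', hH1'⟩
      · refine ⟨hcard, i, hi, ⟨l, hqi ▸ hl, by omega⟩, fun hev => ?_⟩
        rw [Nat.even_iff] at hev
        omega
      · obtain ⟨l', hl', -⟩ := hG.exists_isFreeThread_of_edge hbi hbr hp hac' hg'
          (fun s hs h => (hbal s hs).2.1 (by rw [h, hP']))
        exact ⟨hcard, i, hi, ⟨l, hqi ▸ hl, by omega⟩, fun _ => ⟨l', (hpos' _ hP') ▸ hl'⟩⟩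
    · exact Or.inl ⟨hcard, Nat.even_iff.mpr (by omega), by omega⟩

end Undistinguished

/-! ### Configurations give undistinguished pairs -/

lemma HasFreePair.not_isVertexMetricGenerator (hG : G.Connected) (h : G.HasFreePair S 1) :
    ¬ G.IsVertexMetricGenerator S := by
  obtain ⟨w, b, b', hne, h1, h2⟩ := h
  intro hgen
  obtain ⟨s, hs, hd⟩ := hgen b b' hne
  have := h1.2 s hs
  have := h2.2 s hs
  have := hG.dist_le_dist_add_one s h1.1
  have := hG.dist_le_dist_add_one s h2.1
  omega

lemma HasFreePair.not_isEdgeMetricGenerator (h : G.HasFreePair S 0) :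
    ¬ G.IsEdgeMetricGenerator S := by
  obtain ⟨w, b, b', hne, h1, h2⟩ := h
  intro hgen
  obtain ⟨s, hs, hd⟩ := hgen s(w, b) h1.1 s(w, b') h2.1 fun h => hne (Sym2.congr_right.mp h)
  have := h1.2 s hs
  have := h2.2 s hs
  rw [edgeDist_mk, edgeDist_mk] at hd
  omega

/-- For odd cycles in `ConfigE`: the edge opposite to position `i` has its end `m + k - i + 1`
nearer to `0` and its end `m + k - i` nearer to `k`. -/
lemma cycDist_opposite_edge {m k i t : ℕ} (hi : i ≤ k) (hk : k ≤ m) (ht : t = 0 ∨ t = k) :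
    cycDist (2 * m + 1) t i + (m - k) =
      min (cycDist (2 * m + 1) t (m + k - i)) (cycDist (2 * m + 1) t (m + k - i + 1)) := by
  rcases ht with rfl | rfl
  · have h1 : cycDist (2 * m + 1) 0 i = i := by simp only [cycDist]; omega
    have h2 : cycDist (2 * m + 1) 0 (m + k - i + 1) = m - k + i := by simp only [cycDist]; omega
    have h3 : m - k + i ≤ cycDist (2 * m + 1) 0 (m + k - i) := by simp only [cycDist]; omega
    omega
  · have h1 : cycDist (2 * m + 1) t i = t - i := by simp only [cycDist]; omega
    have h2 : cycDist (2 * m + 1) t (m + t - i) = m - i := by simp only [cycDist]; omega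
    have h3 : m - i ≤ cycDist (2 * m + 1) t (m + t - i + 1) := by simp only [cycDist]; omega
    omega

section Converse

variable {u : V} {p : G.Walk u u}

/-- Reversing a labelling whose only active positions are `0` and `k` replaces `k` by `g - k`, so
minimality gives `2k ≤ g`. -/
lemma IsCactus.gateIdx_of_encard_eq_two (hG : G.IsCactus) (hbi : G.IsBiactive S)
    (hp : G.IsCanonicalCycle S p) (hcard : (G.activeSet S p).encard = 2) :
    0 < G.lastActive S p ∧ 2 * G.lastActive S p ≤ p.length ∧
      ∀ s ∈ S, gateIdx p s = 0 ∨ gateIdx p s = G.lastActive S p := by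
  obtain ⟨hp, hu, hmin⟩ := hp
  have h3 := hp.three_le_length
  obtain ⟨hk, hkact⟩ := lastActive_spec hp ⟨u, hu⟩
  have hpos : 0 < G.lastActive S p := by
    obtain ⟨s, hs, hs0⟩ := hG.exists_gateIdx_ne hbi hp 0
    have := hG.gateIdx_le_lastActive hp hs
    omega
  set k := G.lastActive S p with hkdef
  have huk : u ≠ p.getVert k := by
    intro he
    have := hp.getVert_inj (i := 0) (by omega) hk (p.getVert_zero.trans he)
    omega
  have hactive : {u, p.getVert k} = G.activeSet S p := by
    refine Set.Finite.eq_of_subset_of_encard_le (Set.toFinite _) ?_ ?_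
    · rintro v (rfl | rfl)
      · exact hu
      · exact hkact
    · rw [hcard, Set.encard_pair huk]
  refine ⟨hpos, ?_, fun s hs => ?_⟩
  · have hrev := activeSet_eq_of_edgeSet_eq (S := S) hp hp.reverse p.edgeSet_reverse
    have h1 := hmin u p.reverse hp.reverse p.edgeSet_reverse (by rwa [hrev])
    have h2 : G.lastActive S p.reverse ≤ p.length - k := by
      refine lastActive_le hp.reverse ⟨u, by rwa [hrev]⟩ fun i hi hi' => ?_
      rw [hrev, ← hactive, p.getVert_reverse] at hi'
      rw [Walk.length_reverse] at hi
      rcases Nat.eq_zero_or_pos i with h0 | h0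
      · omega
      rcases hi' with hi' | hi'
      · have := hp.getVert_inj (by omega) (by omega) (hi'.trans p.getVert_zero.symm)
        omega
      · have := hp.getVert_inj (by omega) hk hi'
        omega
    omega
  · have h1 := hG.getVert_gateIdx_mem_activeSet hp hs
    have h2 := hG.gateIdx_lt hp s
    rw [← hactive] at h1
    rcases h1 with h1 | h1
    · exact Or.inl (hp.getVert_inj h2 (by omega) (h1.trans p.getVert_zero.symm))
    · exact Or.inr (hp.getVert_inj h2 hk h1)

/-- Reflection in the axis through the antipodal active vertices exchanges `v_1` with `v_{g-1}`, and
also the two cycle edges at `v_0`. -/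
lemma IsCactus.not_generators_of_configA (hG : G.IsCactus) (hbi : G.IsBiactive S)
    (hp : G.IsCanonicalCycle S p) (h : G.ConfigA S p) :
    ¬ G.IsVertexMetricGenerator S ∧ ¬ G.IsEdgeMetricGenerator S := by
  obtain ⟨hcard, hev, hk⟩ := h
  obtain ⟨hk0, hkg, hgate⟩ := hG.gateIdx_of_encard_eq_two hbi hp hcard
  have hp := hp.1
  have h3 := hp.three_le_length
  rw [Nat.even_iff] at hev
  have hne : p.getVert 1 ≠ p.getVert (p.length - 1) := fun h => by
    have := hp.getVert_inj (by omega) (by omega) h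
    omega
  have hd : ∀ s ∈ S, G.dist s (p.getVert 1) = G.dist s (p.getVert (p.length - 1)) := by
    intro s hs
    rw [hG.dist_getVert hp s (show 1 ≤ p.length by omega),
      hG.dist_getVert hp s (show p.length - 1 ≤ p.length by omega)]
    have := hgate s hs
    simp only [cycDist]
    omega
  refine ⟨fun hgen => ?_, fun hgen => ?_⟩
  · obtain ⟨s, hs, hne'⟩ := hgen _ _ hne
    exact hne' (hd s hs)
  · have hadj1 := p.adj_getVert_succ (i := 0) (by omega)
    have hadj2 := p.adj_getVert_succ (i := p.length - 1) (by omega)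
    rw [p.getVert_zero, zero_add] at hadj1
    rw [show p.length - 1 + 1 = p.length by omega, p.getVert_length] at hadj2
    obtain ⟨s, hs, hne'⟩ := hgen s(u, p.getVert 1) hadj1 s(u, p.getVert (p.length - 1)) hadj2.symm
      fun h => hne (Sym2.congr_right.mp h)
    rw [edgeDist_mk, edgeDist_mk, hd s hs] at hne'
    exact hne' rfl

variable [G.LocallyFinite]

lemma IsCactus.not_isVertexMetricGenerator_of_configC (hG : G.IsCactus) (hbi : G.IsBiactive S)
    (hp : G.IsCanonicalCycle S p) (h : G.ConfigC S p) : ¬ G.IsVertexMetricGenerator S := by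
  obtain ⟨hcard, hev, hk, i, hi, l, hl, hlen⟩ := h
  -- For `k = g/2` the thread vertex used below would be `v_i` itself.
  by_cases hA : G.lastActive S p = p.length / 2
  · exact (hG.not_generators_of_configA hbi hp ⟨hcard, hev, hA⟩).1
  obtain ⟨hk0, hkg, hgate⟩ := hG.gateIdx_of_encard_eq_two hbi hp hcard
  have hp := hp.1
  rw [Nat.even_iff] at hev
  obtain ⟨f, hf0, hm, hfadj, hfd, hfc⟩ := hl.exists_spine hG.1
  intro hgen
  set k := G.lastActive S p with hkdef
  -- The cycle vertex is `v_j` with `j = g/2 + k - i`. Both vertices are at distance `g/2 - k + i`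
  -- from `v_0` and `g/2 - i` from `v_k`.
  obtain ⟨s, hs, hne⟩ := hgen (f (p.length / 2 - k))
    (p.getVert (p.length - i - (p.length / 2 - k))) (fun h =>
      hfc _ (by omega) (by omega) u p hp (h ▸ p.getVert_mem_support _))
  apply hne
  rw [hfd _ (by omega) s hs, hG.dist_getVert hp s (show i ≤ p.length by omega),
    hG.dist_getVert hp s (show p.length - i - (p.length / 2 - k) ≤ p.length by omega)]
  have := hgate s hs
  simp only [cycDist]
  omega

lemma IsCactus.not_isEdgeMetricGenerator_of_configE (hG : G.IsCactus) (hbi : G.IsBiactive S)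
    (hp : G.IsCanonicalCycle S p) (h : G.ConfigE S p) : ¬ G.IsEdgeMetricGenerator S := by
  obtain ⟨hcard, i, hi, ⟨l, hl, hlen⟩, hthread⟩ := h
  by_cases hA : Even p.length ∧ G.lastActive S p = p.length / 2
  · exact (hG.not_generators_of_configA hbi hp ⟨hcard, hA⟩).2
  obtain ⟨hk0, hkg, hgate⟩ := hG.gateIdx_of_encard_eq_two hbi hp hcard
  have hp := hp.1
  obtain ⟨f, hf0, hm, hfadj, hfd, hfc⟩ := hl.exists_spine hG.1
  intro hgen
  set k := G.lastActive S p with hkdef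
  -- The thread edge at distance `t` from `v_i` is matched, for `j = ⌊g/2⌋ + k - i`, with the first
  -- edge of the thread at `v_j` if `g` is even and with `v_j v_{j+1}` if `g` is odd.
  set t := p.length / 2 - k with ht
  have hfoff : f (t + 1) ∉ p.support := hfc _ (by omega) (by omega) u p hp
  have hde : ∀ s ∈ S, G.edgeDist s s(f t, f (t + 1)) =
      G.dist s (p.getVert (gateIdx p s)) + cycDist p.length (gateIdx p s) i + t := by
    intro s hs
    rw [edgeDist_mk, hfd _ (by omega) s hs, hfd _ (by omega) s hs,
      hG.dist_getVert hp s (show i ≤ p.length by omega)]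
    omega
  by_cases hev : Even p.length
  · obtain ⟨l', hl'⟩ := hthread hev
    obtain ⟨f', hf'0, hm', hf'adj, hf'd, hf'c⟩ := hl'.exists_spine hG.1
    rw [Nat.even_iff] at hev hA
    have hadj' := hf'adj 0 (by omega)
    rw [hf'0, zero_add] at hadj'
    set j := p.length / 2 + k - i with hj
    obtain ⟨s, hs, hne⟩ := hgen s(f t, f (t + 1)) (hfadj t (by omega)) s(p.getVert j, f' 1) hadj'
      (fun h => by
        have h1 : p.getVert j ∈ s(f t, f (t + 1)) := by rw [h]; simp
        rcases Sym2.mem_iff.mp h1 with h1 | h1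
        · exact hfc t (by omega) (by omega) u p hp (h1 ▸ p.getVert_mem_support _)
        · exact hfoff (h1 ▸ p.getVert_mem_support _))
    apply hne
    rw [hde s hs, edgeDist_mk, hf'd 1 hm' s hs, hG.dist_getVert hp s (show j ≤ p.length by omega)]
    have := hgate s hs
    simp only [cycDist]
    omega
  · rw [Nat.even_iff] at hev hA
    set j := p.length / 2 + k - i with hj
    obtain ⟨s, hs, hne⟩ := hgen s(f t, f (t + 1)) (hfadj t (by omega))
      s(p.getVert j, p.getVert (j + 1)) (p.adj_getVert_succ (by omega))
      (fun h => by
        have h1 : f (t + 1) ∈ s(p.getVert j, p.getVert (j + 1)) := by rw [← h]; simp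
        rcases Sym2.mem_iff.mp h1 with h1 | h1 <;>
          exact hfoff (h1 ▸ p.getVert_mem_support _))
    apply hne
    rw [hde s hs, edgeDist_mk, hG.dist_getVert hp s (show j ≤ p.length by omega),
      hG.dist_getVert hp s (show j + 1 ≤ p.length by omega)]
    have hodd : p.length = 2 * (p.length / 2) + 1 := by omega
    have := cycDist_opposite_edge hi (show k ≤ p.length / 2 by omega) (hgate s hs)
    rw [← hodd, ← hj] at this
    omega

end Converse

end SimpleGraph

/-! ### The two equivalences -/

theorem theorem3 {V : Type*} [Fintype V] (G : SimpleGraph V) [DecidableRel G.Adj]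
    (hG : G.IsCactus)
    -- `G` is not a path
    (hpath : ¬ (G.IsAcyclic ∧ ∀ v, G.degree v ≤ 2))
    (S : Set V) (hbi : G.IsBiactive S) (hbr : G.IsBranchResolving S) :
    (G.IsVertexMetricGenerator S ↔
      (∀ (u : V) (p : G.Walk u u), G.IsCanonicalCycle S p →
        ¬ G.ConfigA S p ∧ ¬ G.ConfigB S p ∧ ¬ G.ConfigC S p) ∧
      (∀ (u w : V) (p : G.Walk u u) (q : G.Walk w w), p.IsCycle → q.IsCycle →
        ¬ G.VertexCriticallyIncident S p q)) ∧
    (G.IsEdgeMetricGenerator S ↔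
      (∀ (u : V) (p : G.Walk u u), G.IsCanonicalCycle S p →
        ¬ G.ConfigA S p ∧ ¬ G.ConfigD S p ∧ ¬ G.ConfigE S p) ∧
      (∀ (u w : V) (p : G.Walk u u) (q : G.Walk w w), p.IsCycle → q.IsCycle →
        ¬ G.EdgeCriticallyIncident S p q)) := by
  simp only [SimpleGraph.configB_iff, SimpleGraph.configD_iff,
    SimpleGraph.vertexCriticallyIncident_iff, SimpleGraph.edgeCriticallyIncident_iff]
  have hpair : ∀ κ ≤ 1, G.HasFreePair S κ →
      ¬ ((∀ (u : V) (p : G.Walk u u), G.IsCanonicalCycle S p → ¬ G.ConfigThread S κ p) ∧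
        ∀ (u w : V) (p : G.Walk u u) (q : G.Walk w w), p.IsCycle → q.IsCycle →
          ¬ G.CriticallyIncident S κ p q) := by
    rintro κ hκ h ⟨h1, h2⟩
    rcases hG.exists_configThread_or_criticallyIncident hpath hbi hbr hκ h with
      ⟨u, q, hq, hq'⟩ | ⟨u, v, p, q, hp, hq, hpq⟩
    · exact h1 u q hq hq'
    · exact h2 u v p q hp hq hpq
  refine ⟨⟨fun hgen => ⟨fun u p hp => ⟨fun h => ?_, fun h => ?_, fun h => ?_⟩,
      fun u w p q hp hq h => ?_⟩, fun h => ?_⟩,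
    ⟨fun hgen => ⟨fun u p hp => ⟨fun h => ?_, fun h => ?_, fun h => ?_⟩,
      fun u w p q hp hq h => ?_⟩, fun h => ?_⟩⟩
  · exact (hG.not_generators_of_configA hbi hp h).1 hgen
  · exact (hG.hasFreePair_of_configThread le_rfl hp.1 h).not_isVertexMetricGenerator hG.1 hgen
  · exact hG.not_isVertexMetricGenerator_of_configC hbi hp h hgen
  · exact (hG.hasFreePair_of_criticallyIncident hbi le_rfl hp hq h).not_isVertexMetricGenerator
      hG.1 hgen
  · by_contra hgen
    simp only [SimpleGraph.IsVertexMetricGenerator, not_forall, not_exists, not_and, not_not] at hgen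
    obtain ⟨x, x', hxx, hS⟩ := hgen
    rcases hG.exists_config_of_vertices hpath hbi hbr hxx hS with hf | ⟨u, p, hp, hA | hC⟩
    · exact hpair 1 le_rfl hf ⟨fun u p hp => (h.1 u p hp).2.1, h.2⟩
    · exact (h.1 u p hp).1 hA
    · exact (h.1 u p hp).2.2 hC
  · exact (hG.not_generators_of_configA hbi hp h).2 hgen
  · exact (hG.hasFreePair_of_configThread (Nat.zero_le _) hp.1 h).not_isEdgeMetricGenerator hgen
  · exact hG.not_isEdgeMetricGenerator_of_configE hbi hp h hgen
  · exact (hG.hasFreePair_of_criticallyIncident hbi (Nat.zero_le _) hp hq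
      h).not_isEdgeMetricGenerator hgen
  · by_contra hgen
    simp only [SimpleGraph.IsEdgeMetricGenerator, not_forall, not_exists, not_and, not_not] at hgen
    obtain ⟨e, he, f, hf, hef, hS⟩ := hgen
    rcases hG.exists_config_of_edges hpath hbi hbr he hf hef hS with hf | ⟨u, p, hp, hA | hE⟩
    · exact hpair 0 (Nat.zero_le _) hf ⟨fun u p hp => (h.1 u p hp).2.1, h.2⟩
    · exact (h.1 u p hp).1 hA
    · exact (h.1 u p hp).2.2 hE
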